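/- Let $\{x_t\}_{t\in\mathbb Z}$ be a stationary Markov chain with values in the unit vectors $\{e_1,\dots,e_n\}$ of $\mathbb R^n$ and let $\{y_t\}_{t\in\mathbb Z}$ take values in the unit vectors $\{d_1,\dots,d_\ell\}$ of $\mathbb R^\ell$, such that, given $\{x_t\}$, the $y_t$ are independent and the law of $y_{t+1}$ depends on $x_t$ only (a hidden Markov model). Let $A$ ($n\times n$) and $C$ ($\ell\times n$) be the column-stochastic matrices with entries $a_{ij}=\mathbb P(x_{t+1}=e_i\mid x_t=e_j)$ and $c_{ij}=\mathbb P(y_{t+1}=d_i\mid x_t=e_j)$. Put $\pi=\mathbb E[x_t]$, $\bar A=A-\pi\mathbf 1_n^\top$, $\bar y_t=y_t-C\pi$, $\eta_{t+1}=y_{t+1}-Cx_t$ and $R=\mathbb E[\eta_t\eta_t^\top]$. Let $V$ be the covariance matrix of $x_t-\hat x_t$, where $\hat x_t$ is the componentwise orthogonal projection in $L^2$ of $x_t$ onto the closed linear span of the coordinates of all $y_s$, $s\le t$, and let $K=AVC^\top(R+CVC^\top)^\dagger$ be the Kalman gain, where $\dagger$ denotes the Moore–Penrose inverse. Let $\mathcal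 O$ be the infinite matrix with block rows $C\bar A^{j}$ and $\mathcal K$ the infinite matrix with block columns $(A-KC)^{j}K$, $j=0,1,2,\dots$, and let $\mathcal O_k$ and $\mathcal K_k$ consist of their first $k$ blocks. With $$\bar y^+(k)=(\bar y_{1}^\top,\dots,\bar y_{k}^\top)^\top,\qquad \bar y^-(k)=(\bar y_{0}^\top,\bar y_{-1}^\top,\dots,\bar y_{-k+1}^\top)^\top,$$ put $\mathcal H_k=\mathbb E[\bar y^+(k)\,\bar y^-(k)^\top]$, $\Gamma_k=\mathbb E[\bar y^-(k)\,\bar y^-(k)^\top]$ and $\beta_k=\mathcal H_k\Gamma_k^\dagger$. Assume that (A) $A$ is irreducible and aperiodic; (B) $\mathcal O$ has rank $n$ and $\mathcal K$ has rank $n-1$; (C) the eigenvalue $0$ of $R$ is simple. Then there is a $\rho\in(0,1)$ such that $$\|\beta_k-\mathcal O_k\mathcal K_k\|=O(\rho^k)\qquad\text{as }k\to\infty,$$ where $\|\cdot\|$ is the Euclidean operator norm. -/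

import Mathlib

open MeasureTheory Filter Asymptotics
open scoped Matrix

noncomputable section

/-! ### The Moore–Penrose pseudo-inverse of a real matrix -/

/-- The four Penrose equations: `X` is a Moore–Penrose inverse of `A`. -/
structure IsMoorePenrose {m n : Type*} [Fintype m] [Fintype n]
    (A : Matrix m n ℝ) (X : Matrix n m ℝ) : Prop where
  mul_mul_self : A * X * A = A
  self_mul_mul : X * A * X = X
  symm_left : (A * X)ᵀ = A * X
  symm_right : (X * A)ᵀ = X * A

theorem exists_isMoorePenrose_of_isSymm {n : Type*} [Fintype n]
    (H : Matrix n n ℝ) (hH : H.IsSymm) : ∃ X, X.IsSymm ∧ H * X = X * H ∧ H * X * H = H := by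
  classical
  have hh : H.IsHermitian := by
    rw [Matrix.IsHermitian, Matrix.conjTranspose_eq_transpose_of_trivial]; exact hH
  obtain ⟨U, d, hU, hHU⟩ : ∃ (U : Matrix n n ℝ) (d : n → ℝ),
      Uᵀ * U = 1 ∧ H = U * Matrix.diagonal d * Uᵀ := by
    refine ⟨(hh.eigenvectorUnitary : Matrix n n ℝ), hh.eigenvalues, ?_, ?_⟩
    · have := Unitary.coe_star_mul_self hh.eigenvectorUnitary
      rwa [Matrix.star_eq_conjTranspose, Matrix.conjTranspose_eq_transpose_of_trivial] at this
    · have := hh.spectral_theorem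
      rw [Unitary.conjStarAlgAut_apply] at this
      rw [Matrix.star_eq_conjTranspose, Matrix.conjTranspose_eq_transpose_of_trivial] at this
      exact this
  have key : ∀ a b : n → ℝ, (U * Matrix.diagonal a * Uᵀ) * (U * Matrix.diagonal b * Uᵀ)
      = U * Matrix.diagonal (fun i => a i * b i) * Uᵀ := by
    intro a b
    calc _ = U * Matrix.diagonal a * (Uᵀ * U) * Matrix.diagonal b * Uᵀ := by
          simp only [Matrix.mul_assoc]
      _ = _ := by rw [hU, Matrix.mul_one, Matrix.mul_assoc U, Matrix.diagonal_mul_diagonal]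
  refine ⟨U * Matrix.diagonal (fun i => (d i)⁻¹) * Uᵀ, ?_, ?_, ?_⟩
  · simp [Matrix.IsSymm, Matrix.transpose_mul, Matrix.mul_assoc]
  · rw [hHU, key, key]; simp only [mul_comm]
  · rw [hHU, key, key]; congr; ext i; exact mul_inv_mul_cancel _

theorem exists_isMoorePenrose {m n : Type*} [Fintype m] [Fintype n] (A : Matrix m n ℝ) :
    ∃ X, IsMoorePenrose A X := by
  classical
  have hS : (Aᵀ * A).IsSymm := by simp [Matrix.IsSymm, Matrix.transpose_mul]
  obtain ⟨Y, hY, hc, hHY⟩ := exists_isMoorePenrose_of_isSymm _ hS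
  have hYt : Yᵀ = Y := hY
  have h0 : A * (Y * (Aᵀ * A)) = A := by
    have h1 : Aᵀ * A * (Y * (Aᵀ * A) - 1) = 0 := by
      rw [mul_sub, mul_one, ← mul_assoc, hHY, sub_self]
    have h2 : A * (Y * (Aᵀ * A) - 1) = 0 := by
      have := (Matrix.conjTranspose_mul_self_mul_eq_zero A (Y * (Aᵀ * A) - 1)).1
      rw [Matrix.conjTranspose_eq_transpose_of_trivial] at this
      exact this h1
    rwa [Matrix.mul_sub, Matrix.mul_one, sub_eq_zero] at h2
  have hsr : (Y * (Aᵀ * A))ᵀ = Y * (Aᵀ * A) := by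
    rw [Matrix.transpose_mul, hYt, hS]; exact hc
  refine ⟨Y * (Aᵀ * A) * (Y * Aᵀ), ?_, ?_, ?_, ?_⟩
  · calc A * (Y * (Aᵀ * A) * (Y * Aᵀ)) * A = A * (Y * (Aᵀ * A)) * (Y * (Aᵀ * A)) := by
          simp only [Matrix.mul_assoc]
      _ = A := by rw [h0, h0]
  · have h3 : Y * (Aᵀ * A) * (Y * (Aᵀ * A)) = Y * (Aᵀ * A) := by
      rw [Matrix.mul_assoc, ← Matrix.mul_assoc (Aᵀ * A), hHY]
    calc Y * (Aᵀ * A) * (Y * Aᵀ) * A * (Y * (Aᵀ * A) * (Y * Aᵀ))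
        = Y * (Aᵀ * A) * (Y * (Aᵀ * A)) * (Y * (Aᵀ * A)) * (Y * Aᵀ) := by
          simp only [Matrix.mul_assoc]
      _ = _ := by rw [h3, h3]
  · have : A * (Y * (Aᵀ * A) * (Y * Aᵀ)) = A * Y * Aᵀ := by
      calc _ = A * (Y * (Aᵀ * A)) * (Y * Aᵀ) := by simp only [Matrix.mul_assoc]
        _ = _ := by rw [h0, Matrix.mul_assoc]
    rw [this]
    simp [Matrix.transpose_mul, hYt, Matrix.mul_assoc]
  · have h3 : Y * (Aᵀ * A) * (Y * Aᵀ) * A = Y * (Aᵀ * A) := by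
      calc _ = Y * ((Aᵀ * A) * Y * (Aᵀ * A)) := by simp only [Matrix.mul_assoc]
        _ = _ := by rw [hHY]
    rw [h3, hsr]

theorem IsMoorePenrose.unique {m n : Type*} [Fintype m] [Fintype n] {A : Matrix m n ℝ}
    {X Y : Matrix n m ℝ} (hX : IsMoorePenrose A X) (hY : IsMoorePenrose A Y) : X = Y := by
  have h1 : A * X = A * Y := by
    calc A * X = (A * X)ᵀ := hX.symm_left.symm
      _ = ((A * Y) * (A * X))ᵀ := by rw [← Matrix.mul_assoc, hY.mul_mul_self]
      _ = (A * X) * (A * Y) := by rw [Matrix.transpose_mul, hX.symm_left, hY.symm_left]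
      _ = A * Y := by rw [← Matrix.mul_assoc, hX.mul_mul_self]
  have h2 : X * A = Y * A := by
    calc X * A = (X * A)ᵀ := hX.symm_right.symm
      _ = ((X * A) * (Y * A))ᵀ := by
          rw [Matrix.mul_assoc, ← Matrix.mul_assoc A, hY.mul_mul_self]
      _ = (Y * A) * (X * A) := by rw [Matrix.transpose_mul, hX.symm_right, hY.symm_right]
      _ = Y * A := by rw [Matrix.mul_assoc, ← Matrix.mul_assoc A, hX.mul_mul_self]
  calc X = X * A * X := hX.self_mul_mul.symm
    _ = Y * (A * X) := by rw [h2, Matrix.mul_assoc]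
    _ = Y := by rw [h1, ← Matrix.mul_assoc, hY.self_mul_mul]

/-- The Moore–Penrose pseudo-inverse `A†`. -/
def pinv {m n : Type*} [Fintype m] [Fintype n] (A : Matrix m n ℝ) : Matrix n m ℝ :=
  Classical.choose (exists_isMoorePenrose A)

theorem isMoorePenrose_pinv {m n : Type*} [Fintype m] [Fintype n] (A : Matrix m n ℝ) :
    IsMoorePenrose A (pinv A) :=
  Classical.choose_spec (exists_isMoorePenrose A)

/-! ### Hidden Markov models -/

/-- A stationary two-sided hidden Markov model with `n` hidden states and `ℓ` output symbols on
the probability space `(Ω, μ)`. Here `A i j = P(x_{t+1} = i | x_t = j)` and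
`C i j = P(y_{t+1} = i | x_t = j)`. States and symbols are represented by their labels; see
`stateVec` and `obsVec` for the coding by unit vectors. -/
structure StationaryHMM (n ℓ : ℕ) {Ω : Type*} [MeasurableSpace Ω] (μ : Measure Ω) where
  /-- transition probabilities, from the column index to the row index -/
  A : Matrix (Fin n) (Fin n) ℝ
  /-- emission probabilities -/
  C : Matrix (Fin ℓ) (Fin n) ℝ
  /-- the hidden chain -/
  x : ℤ → Ω → Fin n
  /-- the observed process -/
  y : ℤ → Ω → Fin ℓ
  A_nonneg : ∀ i j, 0 ≤ A i j
  A_colSum : ∀ j, ∑ i, A i j = 1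
  C_nonneg : ∀ i j, 0 ≤ C i j
  C_colSum : ∀ j, ∑ i, C i j = 1
  measurable_x : ∀ t, Measurable (x t)
  measurable_y : ∀ t, Measurable (y t)
  /-- the one-dimensional marginals of the hidden chain do not depend on time -/
  stationary : ∀ t i, μ.real {ω | x t ω = i} = μ.real {ω | x 0 ω = i}
  /-- the hidden process is a Markov chain with transition matrix `A` -/
  markov : ∀ (s : ℤ) (m : ℕ) (i : ℕ → Fin n),
    μ.real {ω | ∀ r : ℕ, r ≤ m → x (s + r) ω = i r} =
      μ.real {ω | x s ω = i 0} * ∏ r ∈ Finset.range m, A (i (r + 1)) (i r)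
  /-- given the hidden chain, the observations are independent, and `y_{t+1}` depends on `x_t`
  only, through the emission matrix `C` -/
  emission : ∀ (s : ℤ) (m : ℕ) (i : ℕ → Fin n) (j : ℕ → Fin ℓ),
    μ.real {ω | (∀ r : ℕ, r ≤ m → x (s + r) ω = i r) ∧
        ∀ r : ℕ, r < m → y (s + r + 1) ω = j r} =
      μ.real {ω | ∀ r : ℕ, r ≤ m → x (s + r) ω = i r} * ∏ r ∈ Finset.range m, C (j r) (i r)

namespace StationaryHMM

variable {n ℓ : ℕ} {Ω : Type*} [MeasurableSpace Ω] {μ : Measure Ω} (M : StationaryHMM n ℓ μ)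

/-- The hidden state coded as a unit vector, coordinate `i`. -/
def stateVec (t : ℤ) (i : Fin n) (ω : Ω) : ℝ := if M.x t ω = i then 1 else 0

/-- The observation coded as a unit vector, coordinate `a`. -/
def obsVec (t : ℤ) (a : Fin ℓ) (ω : Ω) : ℝ := if M.y t ω = a then 1 else 0

/-- The stationary distribution of the hidden chain, `π = E[x_t]`. -/
def statDist : Fin n → ℝ := fun i => ∫ ω, M.stateVec 0 i ω ∂μ

/-- The centred observations `y_t - C π`. -/
def obsCentred (t : ℤ) (a : Fin ℓ) (ω : Ω) : ℝ := M.obsVec t a ω - (M.C *ᵥ M.statDist) a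

/-- The observation noise `η_{t+1} = y_{t+1} - C x_t`, indexed by `t + 1`. -/
def obsNoise (t : ℤ) (a : Fin ℓ) (ω : Ω) : ℝ :=
  M.obsVec t a ω - (M.C *ᵥ fun i => M.stateVec (t - 1) i ω) a

/-- The covariance matrix `R = E[η_t η_tᵀ]` of the observation noise. -/
def R : Matrix (Fin ℓ) (Fin ℓ) ℝ :=
  Matrix.of fun a b => ∫ ω, M.obsNoise 0 a ω * M.obsNoise 0 b ω ∂μ

/-- `Ā = A - π 1ᵀ`. -/
def Abar : Matrix (Fin n) (Fin n) ℝ := M.A - Matrix.vecMulVec M.statDist (fun _ => 1)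

/-! ### Linear prediction of the hidden state from the infinite past -/

section Prediction

variable [IsProbabilityMeasure μ]

theorem memLp_stateVec (t : ℤ) (i : Fin n) : MemLp (M.stateVec t i) 2 μ := by
  refine MemLp.of_bound (C := 1) ?_ (ae_of_all _ fun ω => ?_)
  · exact (Measurable.ite (M.measurable_x t (measurableSet_singleton i)) measurable_const
      measurable_const).aestronglyMeasurable
  · unfold stateVec; split_ifs <;> simp

theorem memLp_obsVec (t : ℤ) (a : Fin ℓ) : MemLp (M.obsVec t a) 2 μ := by
  refine MemLp.of_bound (C := 1) ?_ (ae_of_all _ fun ω => ?_)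
  · exact (Measurable.ite (M.measurable_y t (measurableSet_singleton a)) measurable_const
      measurable_const).aestronglyMeasurable
  · unfold obsVec; split_ifs <;> simp

/-- Coordinate `i` of the hidden state as an element of `L²(μ)`. -/
def stateL2 (t : ℤ) (i : Fin n) : Lp ℝ 2 μ := (M.memLp_stateVec t i).toLp (M.stateVec t i)

/-- Coordinate `a` of the observation as an element of `L²(μ)`. -/
def obsL2 (t : ℤ) (a : Fin ℓ) : Lp ℝ 2 μ := (M.memLp_obsVec t a).toLp (M.obsVec t a)

/-- The closed linear span in `L²(μ)` of the coordinates of `y_s`, `s ≤ t`. The constants belong to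
it, because the coordinates of `y_t` sum to one. -/
def past (t : ℤ) : Submodule ℝ (Lp ℝ 2 μ) :=
  (Submodule.span ℝ {f | ∃ (s : ℤ) (a : Fin ℓ), s ≤ t ∧ f = M.obsL2 s a}).topologicalClosure

instance (t : ℤ) : CompleteSpace (M.past t) := by
  unfold past; infer_instance

/-- The optimal linear predictor of the hidden state at time `t` from `y_s`, `s ≤ t`. -/
def statePred (t : ℤ) (i : Fin n) : Lp ℝ 2 μ := (M.past t).starProjection (M.stateL2 t i)

/-- The covariance matrix `V` of the linear prediction error of the hidden state. The inner product
of `L²(μ)` is `E[f g]`, and the prediction error has mean zero. -/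
def V : Matrix (Fin n) (Fin n) ℝ :=
  Matrix.of fun i j => inner ℝ (M.stateL2 0 i - M.statePred 0 i) (M.stateL2 0 j - M.statePred 0 j)

/-- The Kalman gain `K = A V Cᵀ (R + C V Cᵀ)†`. -/
def K : Matrix (Fin n) (Fin ℓ) ℝ := M.A * M.V * M.Cᵀ * pinv (M.R + M.C * M.V * M.Cᵀ)

/-- The infinite matrix `𝒪` with block rows `C Āʳ`, `r = 0, 1, …`. -/
def obsMat : Matrix (ℕ × Fin ℓ) (Fin n) ℝ :=
  Matrix.of fun p i => (M.C * M.Abar ^ p.1) p.2 i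

/-- The infinite matrix `𝒦` with block columns `(A - K C)ʳ K`, `r = 0, 1, …`. -/
def ctrlMat : Matrix (Fin n) (ℕ × Fin ℓ) ℝ :=
  Matrix.of fun i p => ((M.A - M.K * M.C) ^ p.1 * M.K) i p.2

/-- The first `k` block rows of `𝒪`. -/
def obsMatTrunc (k : ℕ) : Matrix (Fin k × Fin ℓ) (Fin n) ℝ :=
  M.obsMat.submatrix (fun p => ((p.1 : ℕ), p.2)) id

/-- The first `k` block columns of `𝒦`. -/
def ctrlMatTrunc (k : ℕ) : Matrix (Fin n) (Fin k × Fin ℓ) ℝ :=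
  M.ctrlMat.submatrix id (fun p => ((p.1 : ℕ), p.2))

end Prediction

/-! ### Linear prediction over a finite horizon -/

/-- The stacked future `(ȳ_{t+1}, …, ȳ_{t+k})` at `t = 0`. -/
def futureVec (k : ℕ) (p : Fin k × Fin ℓ) (ω : Ω) : ℝ := M.obsCentred (1 + (p.1 : ℕ)) p.2 ω

/-- The stacked past `(ȳ_t, ȳ_{t-1}, …, ȳ_{t-k+1})` at `t = 0`. -/
def pastVec (k : ℕ) (p : Fin k × Fin ℓ) (ω : Ω) : ℝ := M.obsCentred (-(p.1 : ℕ)) p.2 ω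

/-- The covariance matrix `ℋ_k` of the future and the past over horizon `k`. -/
def crossCov (k : ℕ) : Matrix (Fin k × Fin ℓ) (Fin k × Fin ℓ) ℝ :=
  Matrix.of fun p q => ∫ ω, M.futureVec k p ω * M.pastVec k q ω ∂μ

/-- The covariance matrix `Γ_k` of the past over horizon `k`. -/
def pastCov (k : ℕ) : Matrix (Fin k × Fin ℓ) (Fin k × Fin ℓ) ℝ :=
  Matrix.of fun p q => ∫ ω, M.pastVec k p ω * M.pastVec k q ω ∂μ

/-- The weight matrix `β_k = ℋ_k Γ_k†` of optimal linear prediction over horizon `k`. -/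
def predMat (k : ℕ) : Matrix (Fin k × Fin ℓ) (Fin k × Fin ℓ) ℝ := M.crossCov k * pinv (M.pastCov k)

/-! ### Conditions on the model -/

/-- The transition matrix is irreducible and aperiodic: the return times of every state have
greatest common divisor one. -/
def Ergodic : Prop :=
  M.A.IsIrreducible ∧ ∀ i, ∀ d : ℕ, (∀ k : ℕ, 0 < k → 0 < (M.A ^ k) i i → d ∣ k) → d = 1

/-- `𝒪` has rank `n` and `𝒦` has rank `n - 1`. -/
def RankCondition [IsProbabilityMeasure μ] : Prop :=
  M.obsMat.eRank = n ∧ M.ctrlMat.eRank + 1 = n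

/-- The eigenvalue `0` of the (symmetric) matrix `R` is simple. -/
def NoiseCondition : Prop :=
  Module.finrank ℝ (Module.End.eigenspace (Matrix.toLin' M.R) 0) = 1

end StationaryHMM

end

/-! Everything takes place in `L²(μ)`, and only second moments matter. Write `F = A - K C`, let
`e_t` be the error of the predictor `x̂_t`, and read a row vector `w` as the functional `w · x`.

Stability of `F`. The error obeys `e_{t+1} = F e_t + v - K η`, with the state noise `v`, the
observation noise `η` and the history pairwise orthogonal. By stationarity `‖w · e_t‖` does not
depend on `t`, so each step gives `‖wF · e‖² + ‖wK · η‖² ≤ ‖w · e‖²` (`norm_linComb_predErr_sq_le`).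
For nonzero `w` of coordinate sum zero some `w F^j K` is nonzero by the rank of `𝒦`. It again has
sum zero, and there `R` is definite because its kernel is spanned by the all-ones vector.
Compactness makes the loss over some `m` steps uniform (`exists_dissip_ge`), so the error norm
contracts under `F^m`. The error norm also dominates that of the centred predictor
(`exists_norm_predC_pow_le`).

Comparison of weights. Unrolling the Kalman filter over `k` steps writes the centred predictor as
the `𝒦_k`-combination of the finite past plus a remainder through `F^k`. A row of `β_k` gives the
projection of a future observation onto the finite past, and the matching row of `𝒪` applied to the
centred predictor gives its projection onto the infinite past. Hence the row of `β_k - 𝒪_k 𝒦_k`,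
applied to the finite past, is the projection of a geometrically small remainder
(`norm_linComb_pastL2_row_le`).

From vectors back to coefficients. The noise at one time correlates with the observation at that
time only, so testing against it isolates one block of coefficients
(`norm_linComb_obsNoiseL2_le_norm_linComb_pastL2`). These blocks have sum zero, so definiteness of
`R` bounds each entry by `c ρ^k`. Passing to the operator norm costs a factor of order `k²`,
absorbed by enlarging `ρ`. -/

noncomputable section

/-! ### Linear combinations and Gram matrices, possibly singular -/

section Gram

variable {E : Type*} [NormedAddCommGroup E] [InnerProductSpace ℝ E]
variable {ι κ : Type*} [Fintype ι] [Fintype κ]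

/-- The linear combination of the family `u` with coefficients `w`. -/
def linComb (u : ι → E) (w : ι → ℝ) : E := ∑ i, w i • u i

/-- The matrix of inner products of two families of vectors. -/
def crossGram (u : ι → E) (v : κ → E) : Matrix ι κ ℝ := Matrix.of fun i j => inner ℝ (u i) (v j)

theorem linComb_add_coeff (u : ι → E) (w w' : ι → ℝ) :
    linComb u (w + w') = linComb u w + linComb u w' := by
  simp [linComb, add_smul, Finset.sum_add_distrib]

theorem linComb_smul_coeff (u : ι → E) (c : ℝ) (w : ι → ℝ) :
    linComb u (c • w) = c • linComb u w := by
  simp [linComb, Finset.smul_sum, mul_smul]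

theorem linComb_add (u v : ι → E) (w : ι → ℝ) :
    linComb (fun i => u i + v i) w = linComb u w + linComb v w := by
  simp [linComb, Finset.sum_add_distrib]

theorem linComb_sub (u v : ι → E) (w : ι → ℝ) :
    linComb (fun i => u i - v i) w = linComb u w - linComb v w := by
  simp [linComb, smul_sub]

theorem linComb_smul_vector (v w : ι → ℝ) (e : E) :
    linComb (fun i => v i • e) w = (w ⬝ᵥ v) • e := by
  simp [linComb, dotProduct, Finset.sum_smul, smul_smul]

theorem linComb_single [DecidableEq ι] (u : ι → E) (i : ι) :
    linComb u (Pi.single i 1) = u i := by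
  simp [linComb, Pi.single_apply]

theorem linComb_linComb (u : κ → E) (B : Matrix ι κ ℝ) (w : ι → ℝ) :
    linComb (fun i => linComb u (B i)) w = linComb u (w ᵥ* B) := by
  simp only [linComb, Matrix.vecMul, dotProduct, Finset.smul_sum, Finset.sum_smul, smul_smul]
  exact Finset.sum_comm

theorem inner_linComb_left (u : ι → E) (w : ι → ℝ) (f : E) :
    inner ℝ (linComb u w) f = ∑ i, w i * inner ℝ (u i) f := by
  simp [linComb, sum_inner, real_inner_smul_left]

theorem inner_linComb_right (u : ι → E) (w : ι → ℝ) (f : E) :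
    inner ℝ f (linComb u w) = ∑ i, w i * inner ℝ f (u i) := by
  simp [linComb, inner_sum, real_inner_smul_right]

theorem norm_linComb_le (u : ι → E) (w : ι → ℝ) : ‖linComb u w‖ ≤ ‖w‖ * ∑ i, ‖u i‖ := by
  rw [linComb, Finset.mul_sum]
  refine (norm_sum_le _ _).trans (Finset.sum_le_sum fun i _ => ?_)
  rw [norm_smul]
  exact mul_le_mul_of_nonneg_right (norm_le_pi_norm w i) (norm_nonneg _)

theorem linComb_mem {S : Submodule ℝ E} {u : ι → E} (h : ∀ i, u i ∈ S) (w : ι → ℝ) :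
    linComb u w ∈ S :=
  S.sum_mem fun i _ => S.smul_mem _ (h i)

theorem continuous_linComb (u : ι → E) : Continuous (linComb u) := by
  unfold linComb; fun_prop

theorem crossGram_mulVec {τ : Type*} (u : τ → E) (v : κ → E) (w : κ → ℝ) (i : τ) :
    (crossGram u v *ᵥ w) i = inner ℝ (u i) (linComb v w) := by
  rw [inner_linComb_right]
  simp [crossGram, Matrix.mulVec, dotProduct, mul_comm]

theorem dotProduct_crossGram_mulVec (u : ι → E) (v : κ → E) (w : ι → ℝ) (w' : κ → ℝ) :
    w ⬝ᵥ (crossGram u v *ᵥ w') = inner ℝ (linComb u w) (linComb v w') := by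
  rw [inner_linComb_left]
  simp [dotProduct, crossGram_mulVec]

theorem norm_linComb_sq (u : ι → E) (w : ι → ℝ) :
    ‖linComb u w‖ ^ 2 = w ⬝ᵥ (crossGram u u *ᵥ w) := by
  rw [dotProduct_crossGram_mulVec, real_inner_self_eq_norm_sq]

theorem linComb_eq_zero_of_crossGram_mulVec {u : ι → E} {w : ι → ℝ}
    (h : crossGram u u *ᵥ w = 0) : linComb u w = 0 := by
  have := norm_linComb_sq u w
  rw [h, dotProduct_zero] at this
  simpa using this

/-- A vector in the kernel of the Gram matrix of `e` gives a vanishing combination of `e`, so it is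
also killed by every cross-Gram matrix with `e`. Thus the normal equations of regression on `e` are
solved by the pseudo-inverse even if `e` is dependent. -/
theorem crossGram_mul_pinv_mul {τ : Type*} (u : τ → E) (e : κ → E) :
    crossGram u e * pinv (crossGram e e) * crossGram e e = crossGram u e := by
  classical
  have h : crossGram e e * (1 - pinv (crossGram e e) * crossGram e e) = 0 := by
    rw [Matrix.mul_sub, Matrix.mul_one, ← Matrix.mul_assoc,
      (isMoorePenrose_pinv (crossGram e e)).mul_mul_self, sub_self]
  have h' : crossGram u e * (1 - pinv (crossGram e e) * crossGram e e) = 0 := by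
    ext i j
    have h1 : crossGram e e *ᵥ ((1 - pinv (crossGram e e) * crossGram e e).col j) = 0 := by
      ext a
      exact congrFun (congrFun h a) j
    have h2 := crossGram_mulVec u e ((1 - pinv (crossGram e e) * crossGram e e).col j) i
    rw [linComb_eq_zero_of_crossGram_mulVec h1, inner_zero_right] at h2
    exact h2
  rw [Matrix.mul_sub, Matrix.mul_one, sub_eq_zero, ← Matrix.mul_assoc] at h'
  exact h'.symm

theorem pinv_mulVec_eq_zero {S : Matrix ι ι ℝ} (hS : S.IsSymm) {v : ι → ℝ} (hv : S *ᵥ v = 0) :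
    pinv S *ᵥ v = 0 := by
  have h := isMoorePenrose_pinv S
  have h1 : pinv S = pinv S * ((pinv S)ᵀ * S) := by
    conv_lhs => rw [← h.self_mul_mul, Matrix.mul_assoc, ← h.symm_left, Matrix.transpose_mul,
      show Sᵀ = S from hS]
  rw [h1, ← Matrix.mulVec_mulVec, ← Matrix.mulVec_mulVec, hv, Matrix.mulVec_zero,
    Matrix.mulVec_zero]

end Gram

/-! ### Compactness, geometric decay and a crude operator norm bound -/

section Estimates

/-- The unit sphere of the sum-zero hyperplane is compact, and the open sets where `f m` exceeds `1
/ (m + 1)` increase with `m` and cover it. Letting the threshold shrink with `m` makes one index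
supply both the horizon and the constant; homogeneity does the rest. -/
theorem exists_pos_mul_sq_norm_le {ι : Type*} [Fintype ι] (f : ℕ → (ι → ℝ) → ℝ)
    (hcont : ∀ m, Continuous (f m)) (hmono : ∀ w, Monotone fun m => f m w)
    (hhom : ∀ m (c : ℝ) w, f m (c • w) = c ^ 2 * f m w)
    (hpos : ∀ w, w ≠ 0 → ∑ i, w i = 0 → ∃ m, 0 < f m w) :
    ∃ m, ∃ δ : ℝ, 0 < δ ∧ ∀ w, ∑ i, w i = 0 → δ * ‖w‖ ^ 2 ≤ f m w := by
  have hK : IsCompact (Metric.sphere (0 : ι → ℝ) 1 ∩ {w | ∑ i, w i = 0}) :=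
    (isCompact_sphere _ _).inter_right (isClosed_eq (by fun_prop) continuous_const)
  obtain ⟨m, hm⟩ := hK.elim_directed_cover (fun m : ℕ => {w | 1 / ((m : ℝ) + 1) < f m w})
    (fun m => isOpen_lt continuous_const (hcont m))
    (by
      rintro w ⟨hw, hw0⟩
      have hne : w ≠ 0 := by rintro rfl; simp at hw
      obtain ⟨m, hm⟩ := hpos w hne hw0
      obtain ⟨N, hN⟩ := exists_nat_one_div_lt hm
      refine Set.mem_iUnion.2 ⟨max m N, ?_⟩
      refine lt_of_le_of_lt ?_ (hN.trans_le (hmono w (le_max_left m N)))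
      refine one_div_le_one_div_of_le (by positivity) ?_
      have : (N : ℝ) ≤ ((max m N : ℕ) : ℝ) := by exact_mod_cast le_max_right m N
      linarith)
    (by
      refine (Monotone.directed_le (f := fun m : ℕ => {w | 1 / ((m : ℝ) + 1) < f m w}) ?_)
      intro a b hab w hw
      refine lt_of_le_of_lt ?_ (lt_of_lt_of_le hw (hmono w hab))
      refine one_div_le_one_div_of_le (by positivity) ?_
      have : (a : ℝ) ≤ (b : ℝ) := by exact_mod_cast hab
      linarith)
  refine ⟨m, 1 / ((m : ℝ) + 1), by positivity, fun w hw => ?_⟩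
  rcases eq_or_ne w 0 with rfl | hne
  · have := hhom m 0 0
    simp at this
    simp [this]
  · have hn : ‖w‖ ≠ 0 := norm_ne_zero_iff.2 hne
    have h1 : (‖w‖⁻¹ • w) ∈ Metric.sphere (0 : ι → ℝ) 1 ∩ {w | ∑ i, w i = 0} := by
      refine ⟨by simp [norm_smul, hn], ?_⟩
      simp [← Finset.mul_sum, hw]
    have h2 : 1 / ((m : ℝ) + 1) < f m (‖w‖⁻¹ • w) := hm h1
    rw [hhom] at h2
    have h3 : ‖w‖ ^ 2 * (‖w‖⁻¹ ^ 2 * f m w) = f m w := by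
      field_simp
    rw [← h3, mul_comm]
    exact mul_le_mul_of_nonneg_left h2.le (by positivity)

/-- The rate is `θ^(1/m)`, and the constant `θ⁻¹` pays for the indices below `m`, where only
monotonicity is available. Both are chosen before the sequence, so the bound is uniform over
starting vectors. -/
theorem exists_geometric_bound {θ : ℝ} (hθ0 : 0 < θ) (hθ1 : θ < 1) {m : ℕ} (hm : 0 < m) :
    ∃ ρ : ℝ, 0 < ρ ∧ ρ < 1 ∧ ∃ c : ℝ, 0 ≤ c ∧ ∀ a : ℕ → ℝ, 0 ≤ a 0 → Antitone a →
      (∀ k, a (k + m) ≤ θ * a k) → ∀ k, a k ≤ c * ρ ^ k * a 0 := by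
  refine ⟨θ ^ ((m : ℝ)⁻¹), by positivity, Real.rpow_lt_one hθ0.le hθ1 (by positivity), θ⁻¹,
    by positivity, fun a ha hanti hstep k => ?_⟩
  set ρ := θ ^ ((m : ℝ)⁻¹) with hρ
  have hρ0 : 0 < ρ := by positivity
  have hρ1 : ρ < 1 := Real.rpow_lt_one hθ0.le hθ1 (by positivity)
  have hρm : ρ ^ m = θ := Real.rpow_inv_natCast_pow hθ0.le hm.ne'
  induction k using Nat.strong_induction_on with
  | _ k ih =>
    rcases lt_or_ge k m with hk | hk
    · have h1 : θ ≤ ρ ^ k := by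
        rw [← hρm]; exact pow_le_pow_of_le_one hρ0.le hρ1.le hk.le
      have h2 : 1 ≤ θ⁻¹ * ρ ^ k := by
        rw [inv_mul_eq_div, le_div_iff₀ hθ0]; linarith
      calc a k ≤ 1 * a 0 := by simpa using hanti (Nat.zero_le k)
        _ ≤ _ := mul_le_mul_of_nonneg_right h2 ha
    · obtain ⟨r, rfl⟩ := Nat.exists_eq_add_of_le' hk
      calc a (r + m) ≤ θ * a r := hstep r
        _ ≤ θ * (θ⁻¹ * ρ ^ r * a 0) := mul_le_mul_of_nonneg_left (ih r (by omega)) hθ0.le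
        _ = _ := by rw [pow_add, hρm]; ring

theorem norm_toEuclideanCLM_le {ι : Type*} [Fintype ι] [DecidableEq ι] (B : Matrix ι ι ℝ) {c : ℝ}
    (hc : 0 ≤ c) (hB : ∀ i j, |B i j| ≤ c) :
    ‖Matrix.toEuclideanCLM (𝕜 := ℝ) B‖ ≤ (Fintype.card ι : ℝ) ^ 2 * c := by
  refine ContinuousLinearMap.opNorm_le_bound _ (by positivity) fun x => ?_
  have h1 : ∀ i, |(Matrix.toEuclideanCLM (𝕜 := ℝ) B x) i| ≤ Fintype.card ι * (c * ‖x‖) := by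
    intro i
    have : (Matrix.toEuclideanCLM (𝕜 := ℝ) B x) i = ∑ j, B i j * x j := by
      simp [Matrix.mulVec, dotProduct]
    rw [this]
    calc |∑ j, B i j * x j| ≤ ∑ j, |B i j * x j| := Finset.abs_sum_le_sum_abs _ _
      _ ≤ ∑ _j : ι, c * ‖x‖ := Finset.sum_le_sum fun j _ => by
          rw [abs_mul]
          exact mul_le_mul (hB i j) (PiLp.norm_apply_le x j) (abs_nonneg _) hc
      _ = _ := by simp
  have h2 : ‖Matrix.toEuclideanCLM (𝕜 := ℝ) B x‖ ≤
      ∑ i, |(Matrix.toEuclideanCLM (𝕜 := ℝ) B x) i| := by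
    rw [EuclideanSpace.norm_eq]
    refine Real.sqrt_le_iff.2 ⟨Finset.sum_nonneg fun i _ => abs_nonneg _, ?_⟩
    exact Finset.sum_sq_le_sq_sum_of_nonneg fun i _ => norm_nonneg _
  calc _ ≤ _ := h2
    _ ≤ ∑ _i : ι, Fintype.card ι * (c * ‖x‖) := Finset.sum_le_sum fun i _ => h1 i
    _ = _ := by simp; ring

end Estimates

end

noncomputable section

/-! ### Finite windows of the model and one-step conditional expectations -/

namespace StationaryHMM

variable {n ℓ : ℕ} {Ω : Type*} [MeasurableSpace Ω] {μ : Measure Ω} (M : StationaryHMM n ℓ μ)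

/-- The states at the times `s, …, s + m` and the observations at the times `s + 1, …, s + m`. -/
def window (s : ℤ) (m : ℕ) (ω : Ω) : (Fin (m + 1) → Fin n) × (Fin m → Fin ℓ) :=
  (fun r => M.x (s + (r : ℕ)) ω, fun r => M.y (s + (r : ℕ) + 1) ω)

theorem measurable_window (s : ℤ) (m : ℕ) : Measurable (M.window s m) :=
  (measurable_pi_lambda _ fun _ => M.measurable_x _).prodMk
    (measurable_pi_lambda _ fun _ => M.measurable_y _)

theorem measureReal_window (s : ℤ) (m : ℕ) (i : ℕ → Fin n) (j : ℕ → Fin ℓ) :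
    μ.real {ω | M.window s m ω = (fun r : Fin (m + 1) => i r, fun r : Fin m => j r)} =
      μ.real {ω | M.x s ω = i 0} * (∏ r ∈ Finset.range m, M.A (i (r + 1)) (i r)) *
        ∏ r ∈ Finset.range m, M.C (j r) (i r) := by
  rw [← M.markov, ← M.emission]
  congr 1
  ext ω
  simp only [window, Prod.mk.injEq, Set.mem_ofPred_eq, funext_iff, Fin.forall_iff, Nat.lt_succ_iff]

theorem measureReal_window_succ (s : ℤ) (m : ℕ) (w : (Fin (m + 1) → Fin n) × (Fin m → Fin ℓ))
    (i' : Fin n) (b : Fin ℓ) :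
    μ.real {ω | M.window s m ω = w ∧ M.x (s + m + 1) ω = i' ∧ M.y (s + m + 1) ω = b} =
      μ.real {ω | M.window s m ω = w} * (M.A i' (w.1 (Fin.last m)) * M.C b (w.1 (Fin.last m))) := by
  obtain ⟨p, q⟩ := w
  -- The default values are the newly appended symbols: `I` takes `i'` at `m + 1` and `J` takes `b`
  -- at `m`, so the same sequences describe the window and its extension.
  set I : ℕ → Fin n := fun r => if h : r < m + 1 then p ⟨r, h⟩ else i' with hI
  set J : ℕ → Fin ℓ := fun r => if h : r < m then q ⟨r, h⟩ else b with hJ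
  have h1 : ((fun r : Fin (m + 1) => I r, fun r : Fin m => J r) : (Fin (m + 1) → Fin n) × (Fin m → Fin ℓ)) = (p, q) := by
    refine Prod.ext (funext fun r => ?_) (funext fun r => ?_)
    · exact dif_pos r.2
    · exact dif_pos r.2
  have hIm : I m = p (Fin.last m) := by simp [hI, Fin.last]
  have hI1 : I (m + 1) = i' := by simp [hI]
  have hJm : J m = b := by simp [hJ]
  have h2 : {ω | M.window s m ω = (p, q) ∧ M.x (s + m + 1) ω = i' ∧ M.y (s + m + 1) ω = b} =
      {ω | M.window s (m + 1) ω = (fun r : Fin (m + 1 + 1) => I r, fun r : Fin (m + 1) => J r)} := by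
    ext ω
    rw [← h1]
    simp only [window, Prod.mk.injEq, Set.mem_ofPred_eq, funext_iff]
    rw [Fin.forall_fin_succ' (n := m + 1),
      Fin.forall_fin_succ' (n := m) (P := fun r => M.y (s + (r : ℕ) + 1) ω = J r)]
    simp only [Fin.val_castSucc, Fin.val_last, hI1, hJm, Nat.cast_add, Nat.cast_one, ← add_assoc]
    tauto
  rw [h2, ← h1, measureReal_window, measureReal_window, Finset.prod_range_succ,
    Finset.prod_range_succ, hI1, hJm]
  simp only [Fin.val_last, hIm]
  ring

theorem sum_stateVec (t : ℤ) (ω : Ω) : ∑ i, M.stateVec t i ω = 1 := by simp [stateVec]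

theorem sum_obsVec (t : ℤ) (ω : Ω) : ∑ i, M.obsVec t i ω = 1 := by simp [obsVec]

theorem sum_mul_stateVec (f : Fin n → ℝ) (t : ℤ) (ω : Ω) :
    ∑ i, f i * M.stateVec t i ω = f (M.x t ω) := by simp [stateVec]

theorem integrable_window_mul (s : ℤ) (m : ℕ)
    (g : (Fin (m + 1) → Fin n) × (Fin m → Fin ℓ) → ℝ) {φ : Ω → ℝ} (hφ : Integrable φ μ) :
    Integrable (fun ω => g (M.window s m ω) * φ ω) μ := by
  obtain ⟨c, hc⟩ := (Set.finite_range fun w => ‖g w‖).bddAbove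
  refine hφ.bdd_mul (c := c) ?_ (ae_of_all _ fun ω => hc ⟨_, rfl⟩)
  exact ((measurable_of_countable g).comp (M.measurable_window s m)).aestronglyMeasurable

theorem integral_stateVec (t : ℤ) (i : Fin n) : ∫ ω, M.stateVec t i ω ∂μ = M.statDist i := by
  have h : ∀ t, ∫ ω, M.stateVec t i ω ∂μ = μ.real {ω | M.x t ω = i} := by
    intro t
    have : M.stateVec t i = Set.indicator {ω | M.x t ω = i} 1 := by
      ext ω; simp [stateVec, Set.indicator_apply]
    rw [this, integral_indicator_one]
    exact M.measurable_x t (measurableSet_singleton i)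
  rw [statDist, h, h, M.stationary]

theorem inner_toLp {f g : Ω → ℝ} (hf : MemLp f 2 μ) (hg : MemLp g 2 μ) :
    inner ℝ (hf.toLp f) (hg.toLp g) = ∫ ω, f ω * g ω ∂μ := by
  rw [L2.inner_def]
  refine integral_congr_ae ?_
  filter_upwards [hf.coeFn_toLp, hg.coeFn_toLp] with ω h1 h2
  simp [h1, h2, mul_comm]

theorem one_vecMul_C : (1 : Fin ℓ → ℝ) ᵥ* M.C = 1 := by
  ext j; simp [Matrix.vecMul, dotProduct, M.C_colSum]

theorem one_vecMul_A : (1 : Fin n → ℝ) ᵥ* M.A = 1 := by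
  ext j; simp [Matrix.vecMul, dotProduct, M.A_colSum]

section Probability

variable [IsProbabilityMeasure μ]

theorem integral_comp_eq_sum {τ : Type*} [Fintype τ] [MeasurableSpace τ]
    [MeasurableSingletonClass τ] {Z : Ω → τ} (hZ : Measurable Z) (g : τ → ℝ) :
    ∫ ω, g (Z ω) ∂μ = ∑ z, μ.real {ω | Z ω = z} * g z := by
  classical
  rw [← integral_map (f := g) hZ.aemeasurable
    (measurable_of_countable g).aestronglyMeasurable]
  rw [integral_fintype (Integrable.of_finite)]
  refine Finset.sum_congr rfl fun z _ => ?_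
  rw [map_measureReal_apply hZ (measurableSet_singleton z), smul_eq_mul]
  rfl

/-- The product `A · C` on the right expresses that the next state and the next observation are
conditionally independent given the current state. Summing out one of them yields the two separate
transition rules, and the joint form later makes the two noises uncorrelated. -/
theorem integral_window_step (s : ℤ) (m : ℕ)
    (g : (Fin (m + 1) → Fin n) × (Fin m → Fin ℓ) → ℝ) (i' : Fin n) (b : Fin ℓ) :
    ∫ ω, g (M.window s m ω) * (M.stateVec (s + m + 1) i' ω * M.obsVec (s + m + 1) b ω) ∂μ =
      ∫ ω, g (M.window s m ω) * (M.A i' (M.x (s + m) ω) * M.C b (M.x (s + m) ω)) ∂μ := by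
  have h1 := integral_comp_eq_sum (μ := μ)
    (Z := fun ω => (M.window s m ω, M.x (s + m + 1) ω, M.y (s + m + 1) ω))
    ((M.measurable_window s m).prodMk ((M.measurable_x _).prodMk (M.measurable_y _)))
    (fun z => g z.1 * ((if z.2.1 = i' then 1 else 0) * (if z.2.2 = b then 1 else 0)))
  have h2 := integral_comp_eq_sum (μ := μ) (M.measurable_window s m)
    (fun w => g w * (M.A i' (w.1 (Fin.last m)) * M.C b (w.1 (Fin.last m))))
  refine h1.trans (Eq.trans ?_ h2.symm)
  rw [Fintype.sum_prod_type]
  refine Finset.sum_congr rfl fun w _ => ?_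
  rw [Fintype.sum_prod_type]
  rw [Finset.sum_eq_single i' (fun c _ hc => by simp [hc]) (by simp)]
  rw [Finset.sum_eq_single b (fun c _ hc => by simp [hc]) (by simp)]
  simp only [Prod.mk.injEq, if_true, mul_one]
  rw [measureReal_window_succ]
  ring

theorem integrable_stateVec (t : ℤ) (i : Fin n) : Integrable (M.stateVec t i) μ :=
  (M.memLp_stateVec t i).integrable (by norm_num)

theorem integrable_stateVec_mul_obsVec (t t' : ℤ) (i : Fin n) (a : Fin ℓ) :
    Integrable (fun ω => M.stateVec t i ω * M.obsVec t' a ω) μ :=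
  (M.memLp_stateVec t i).integrable_mul (M.memLp_obsVec t' a)

theorem integral_window_mul_stateVec (s : ℤ) (m : ℕ)
    (g : (Fin (m + 1) → Fin n) × (Fin m → Fin ℓ) → ℝ) (i' : Fin n) :
    ∫ ω, g (M.window s m ω) * M.stateVec (s + m + 1) i' ω ∂μ =
      ∑ j, M.A i' j * ∫ ω, g (M.window s m ω) * M.stateVec (s + m) j ω ∂μ := by
  have h := Finset.sum_congr rfl fun b (_ : b ∈ Finset.univ) => M.integral_window_step s m g i' b
  rw [← integral_finsetSum _ fun b _ => M.integrable_window_mul s m g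
      (M.integrable_stateVec_mul_obsVec _ _ i' b),
    ← integral_finsetSum] at h
  · simp only [← Finset.mul_sum, sum_obsVec, M.C_colSum, mul_one] at h
    rw [h]
    simp only [← integral_const_mul]
    rw [← integral_finsetSum _ fun b _ => (M.integrable_window_mul s m g
      (M.integrable_stateVec _ _)).const_mul _]
    congr 1
    ext ω
    rw [← M.sum_mul_stateVec (M.A i'), Finset.mul_sum]
    exact Finset.sum_congr rfl fun _ _ => by ring
  · intro b _
    refine M.integrable_window_mul s m g ?_
    simp only [← M.sum_mul_stateVec (fun k => M.A i' k * M.C b k)]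
    exact integrable_finsetSum _ fun k _ => (M.integrable_stateVec _ _).const_mul _

theorem integral_window_mul_obsVec (s : ℤ) (m : ℕ)
    (g : (Fin (m + 1) → Fin n) × (Fin m → Fin ℓ) → ℝ) (b : Fin ℓ) :
    ∫ ω, g (M.window s m ω) * M.obsVec (s + m + 1) b ω ∂μ =
      ∑ j, M.C b j * ∫ ω, g (M.window s m ω) * M.stateVec (s + m) j ω ∂μ := by
  have h := Finset.sum_congr rfl fun i' (_ : i' ∈ Finset.univ) => M.integral_window_step s m g i' b
  rw [← integral_finsetSum _ fun i' _ => M.integrable_window_mul s m g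
      (M.integrable_stateVec_mul_obsVec _ _ i' b),
    ← integral_finsetSum] at h
  · simp only [← Finset.mul_sum, ← Finset.sum_mul, sum_stateVec, M.A_colSum, one_mul] at h
    rw [h]
    simp only [← integral_const_mul]
    rw [← integral_finsetSum _ fun b _ => (M.integrable_window_mul s m g
      (M.integrable_stateVec _ _)).const_mul _]
    congr 1
    ext ω
    rw [← M.sum_mul_stateVec (M.C b), Finset.mul_sum]
    exact Finset.sum_congr rfl fun _ _ => by ring
  · intro i' _
    refine M.integrable_window_mul s m g ?_
    simp only [← M.sum_mul_stateVec (fun k => M.A i' k * M.C b k)]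
    exact integrable_finsetSum _ fun k _ => (M.integrable_stateVec _ _).const_mul _

/-! ### Moments in `L²` -/

theorem integral_obsVec (t : ℤ) (a : Fin ℓ) :
    ∫ ω, M.obsVec t a ω ∂μ = (M.C *ᵥ M.statDist) a := by
  have h := M.integral_window_mul_obsVec (t - 1) 0 (fun _ => 1) a
  simpa [integral_stateVec, Matrix.mulVec, dotProduct] using h

theorem mulVec_statDist : M.A *ᵥ M.statDist = M.statDist := by
  ext i
  have h := M.integral_window_mul_stateVec 0 0 (fun _ => 1) i
  simp only [one_mul, integral_stateVec] at h
  simpa [Matrix.mulVec, dotProduct] using h.symm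

theorem inner_stateL2_stateL2_self (t : ℤ) (i j : Fin n) :
    inner ℝ (M.stateL2 t i) (M.stateL2 t j) = if i = j then M.statDist i else 0 := by
  rw [stateL2, stateL2, inner_toLp]
  split_ifs with h
  · subst h
    rw [← M.integral_stateVec t i]
    congr 1; ext ω; simp [stateVec]
  · rw [← integral_zero Ω ℝ (μ := μ)]
    congr 1; ext ω
    simp only [stateVec]
    split_ifs with h1 h2 <;> simp_all

theorem inner_obsL2_obsL2_self (t : ℤ) (a b : Fin ℓ) :
    inner ℝ (M.obsL2 t a) (M.obsL2 t b) = if a = b then (M.C *ᵥ M.statDist) a else 0 := by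
  rw [obsL2, obsL2, inner_toLp]
  split_ifs with h
  · subst h
    rw [← M.integral_obsVec t a]
    congr 1; ext ω; simp [obsVec]
  · rw [← integral_zero Ω ℝ (μ := μ)]
    congr 1; ext ω
    simp only [obsVec]
    split_ifs with h1 h2 <;> simp_all

theorem inner_stateL2_obsL2_self (t : ℤ) (i : Fin n) (b : Fin ℓ) :
    inner ℝ (M.stateL2 t i) (M.obsL2 t b) = ∑ j, M.A i j * M.C b j * M.statDist j := by
  rw [stateL2, obsL2, inner_toLp]
  have h := M.integral_window_step (t - 1) 0 (fun _ => 1) i b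
  simp only [one_mul, Nat.cast_zero, add_zero, sub_add_cancel] at h
  rw [h]
  simp only [← M.sum_mul_stateVec (fun k => M.A i k * M.C b k)]
  rw [integral_finsetSum _ fun k _ => (M.integrable_stateVec _ _).const_mul _]
  simp only [integral_const_mul, integral_stateVec]

theorem inner_stateL2_succ_stateL2 {s t : ℤ} (h : s ≤ t) (i j : Fin n) :
    inner ℝ (M.stateL2 (t + 1) i) (M.stateL2 s j) =
      ∑ k, M.A i k * inner ℝ (M.stateL2 t k) (M.stateL2 s j) := by
  obtain ⟨m, rfl⟩ := Int.le.dest h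
  have h := M.integral_window_mul_stateVec s m (fun w => if w.1 0 = j then 1 else 0) i
  simp only [stateL2, inner_toLp]
  simpa [window, stateVec, mul_comm] using h

theorem inner_obsL2_succ_stateL2 {s t : ℤ} (h : s ≤ t) (b : Fin ℓ) (j : Fin n) :
    inner ℝ (M.obsL2 (t + 1) b) (M.stateL2 s j) =
      ∑ k, M.C b k * inner ℝ (M.stateL2 t k) (M.stateL2 s j) := by
  obtain ⟨m, rfl⟩ := Int.le.dest h
  have h := M.integral_window_mul_obsVec s m (fun w => if w.1 0 = j then 1 else 0) b
  simp only [stateL2, obsL2, inner_toLp]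
  simpa [window, stateVec, obsVec, mul_comm] using h

theorem inner_stateL2_succ_obsL2 {s t : ℤ} (h : s ≤ t) (i : Fin n) (a : Fin ℓ) :
    inner ℝ (M.stateL2 (t + 1) i) (M.obsL2 s a) =
      ∑ k, M.A i k * inner ℝ (M.stateL2 t k) (M.obsL2 s a) := by
  obtain ⟨m, rfl⟩ := Int.le.dest h
  -- A window starting at `s` shows observations only from `s + 1` on, so it must start one step
  -- earlier to contain `y_s`.
  have h := M.integral_window_mul_stateVec (s - 1) (m + 1) (fun w => if w.2 0 = a then 1 else 0) i
  have e : s - 1 + ((m + 1 : ℕ) : ℤ) = s + m := by push_cast; ring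
  rw [e] at h
  simp only [stateL2, obsL2, inner_toLp]
  simpa [window, stateVec, obsVec, mul_comm] using h

theorem inner_obsL2_succ_obsL2 {s t : ℤ} (h : s ≤ t) (b a : Fin ℓ) :
    inner ℝ (M.obsL2 (t + 1) b) (M.obsL2 s a) =
      ∑ k, M.C b k * inner ℝ (M.stateL2 t k) (M.obsL2 s a) := by
  obtain ⟨m, rfl⟩ := Int.le.dest h
  have h := M.integral_window_mul_obsVec (s - 1) (m + 1) (fun w => if w.2 0 = a then 1 else 0) b
  have e : s - 1 + ((m + 1 : ℕ) : ℤ) = s + m := by push_cast; ring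
  rw [e] at h
  simp only [stateL2, obsL2, inner_toLp]
  simpa [window, stateVec, obsVec, mul_comm] using h

/-! ### Invariance of the second moments under time shifts -/

theorem inner_stateL2_stateL2_shift (h s t : ℤ) (i j : Fin n) :
    inner ℝ (M.stateL2 (s + h) i) (M.stateL2 (t + h) j) =
      inner ℝ (M.stateL2 s i) (M.stateL2 t j) := by
  have key : ∀ t s : ℤ, t ≤ s → ∀ i j, inner ℝ (M.stateL2 (s + h) i) (M.stateL2 (t + h) j) =
      inner ℝ (M.stateL2 s i) (M.stateL2 t j) := by
    intro t s hts
    induction s, hts using Int.leInduction with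
    | base => intro i j; rw [inner_stateL2_stateL2_self, inner_stateL2_stateL2_self]
    | succ s hs ih =>
      intro i j
      rw [add_right_comm, inner_stateL2_succ_stateL2 _ (by omega),
        inner_stateL2_succ_stateL2 _ hs]
      simp only [ih]
  rcases le_total t s with hts | hts
  · exact key t s hts i j
  · rw [real_inner_comm, key s t hts, real_inner_comm]

theorem inner_stateL2_obsL2_shift (h s t : ℤ) (i : Fin n) (a : Fin ℓ) :
    inner ℝ (M.stateL2 (s + h) i) (M.obsL2 (t + h) a) =
      inner ℝ (M.stateL2 s i) (M.obsL2 t a) := by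
  rcases lt_or_ge s t with hst | hts
  · obtain ⟨r, rfl⟩ : ∃ r, t = r + 1 := ⟨t - 1, by ring⟩
    rw [real_inner_comm, add_right_comm, inner_obsL2_succ_stateL2 _ (by omega),
      real_inner_comm (M.obsL2 (r + 1) a), inner_obsL2_succ_stateL2 _ (by omega)]
    simp only [inner_stateL2_stateL2_shift]
  · revert i
    induction s, hts using Int.leInduction with
    | base => intro i; rw [inner_stateL2_obsL2_self, inner_stateL2_obsL2_self]
    | succ s hs ih =>
      intro i
      rw [add_right_comm, inner_stateL2_succ_obsL2 _ (by omega), inner_stateL2_succ_obsL2 _ hs]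
      simp only [ih]

theorem inner_obsL2_obsL2_shift (h s t : ℤ) (a b : Fin ℓ) :
    inner ℝ (M.obsL2 (s + h) a) (M.obsL2 (t + h) b) =
      inner ℝ (M.obsL2 s a) (M.obsL2 t b) := by
  have key : ∀ t s : ℤ, t < s → ∀ a b, inner ℝ (M.obsL2 (s + h) a) (M.obsL2 (t + h) b) =
      inner ℝ (M.obsL2 s a) (M.obsL2 t b) := by
    intro t s hts a b
    obtain ⟨r, rfl⟩ : ∃ r, s = r + 1 := ⟨s - 1, by ring⟩
    rw [add_right_comm, inner_obsL2_succ_obsL2 _ (by omega), inner_obsL2_succ_obsL2 _ (by omega)]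
    simp only [inner_stateL2_obsL2_shift]
  rcases lt_trichotomy t s with hts | rfl | hts
  · exact key t s hts a b
  · rw [inner_obsL2_obsL2_self, inner_obsL2_obsL2_self]
  · rw [real_inner_comm, key s t hts, real_inner_comm]

end Probability

end StationaryHMM

end

noncomputable section

/-! ### Orthogonality to closed spans, and isometry expressed by pairs -/

section Span

variable {E : Type*} [NormedAddCommGroup E] [InnerProductSpace ℝ E]

theorem inner_eq_zero_of_mem_closure_span {S : Set E} {g : E} (h : ∀ f ∈ S, inner ℝ g f = 0) :
    ∀ f ∈ (Submodule.span ℝ S).topologicalClosure, inner ℝ g f = 0 := by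
  have h1 : (Submodule.span ℝ S).topologicalClosure ≤ (Submodule.span ℝ {g})ᗮ := by
    refine Submodule.topologicalClosure_minimal _ (Submodule.span_le.2 fun f hf => ?_)
      (Submodule.isClosed_orthogonal _)
    exact Submodule.mem_orthogonal_singleton_iff_inner_right.2 (h f hf)
  exact fun f hf => Submodule.mem_orthogonal_singleton_iff_inner_right.1 (h1 hf)

/-- The span of `T` serves as the graph of a linear isometry, so no operator has to be constructed
or shown to be well defined. -/
theorem inner_fst_eq_inner_snd_of_mem_span {T : Set (E × E)}
    (hT : ∀ p ∈ T, ∀ q ∈ T, inner ℝ p.1 q.1 = inner ℝ p.2 q.2) {p q : E × E}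
    (hp : p ∈ Submodule.span ℝ T) (hq : q ∈ Submodule.span ℝ T) :
    inner ℝ p.1 q.1 = inner ℝ p.2 q.2 := by
  induction hp, hq using Submodule.span_induction₂ with
  | mem_mem x y hx hy => exact hT x hx y hy
  | zero_left y hy => simp
  | zero_right x hx => simp
  | add_left x y z _ _ _ h1 h2 => simp [inner_add_left, h1, h2]
  | add_right x y z _ _ _ h1 h2 => simp [inner_add_right, h1, h2]
  | smul_left r x y _ _ h => simp [real_inner_smul_left, h]
  | smul_right r x y _ _ h => simp [real_inner_smul_right, h]

end Span

/-! ### Histories, noises and their orthogonality -/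

namespace StationaryHMM

theorem toLp_sum_mul {Ω : Type*} [MeasurableSpace Ω] {μ : Measure Ω} {ι : Type*} [Fintype ι]
    {f : ι → Ω → ℝ} (hf : ∀ i, MemLp (f i) 2 μ) (w : ι → ℝ)
    (h : MemLp (fun ω => ∑ i, w i * f i ω) 2 μ) :
    h.toLp (fun ω => ∑ i, w i * f i ω) = linComb (fun i => (hf i).toLp (f i)) w := by
  refine Lp.ext ?_
  have h1 : ∀ᵐ ω ∂μ, ∀ i, ((w i • (hf i).toLp (f i) : Lp ℝ 2 μ) : Ω → ℝ) ω = w i * f i ω := by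
    rw [ae_all_iff]
    intro i
    filter_upwards [Lp.coeFn_smul (w i) ((hf i).toLp (f i)), (hf i).coeFn_toLp] with ω h1 h2
    simp [h1, h2]
  filter_upwards [h.coeFn_toLp, Lp.coeFn_fun_finsetSum Finset.univ
    fun i => w i • (hf i).toLp (f i), h1] with ω h2 h3 h4
  rw [h2, linComb, h3]
  exact Finset.sum_congr rfl fun i _ => (h4 i).symm

variable {n ℓ : ℕ} {Ω : Type*} [MeasurableSpace Ω] {μ : Measure Ω} [IsProbabilityMeasure μ]
  (M : StationaryHMM n ℓ μ)

/-- The closed linear span in `L²(μ)` of the states and the observations up to time `t`. -/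
def hist (t : ℤ) : Submodule ℝ (Lp ℝ 2 μ) :=
  (Submodule.span ℝ {f | (∃ (s : ℤ) (i : Fin n), s ≤ t ∧ f = M.stateL2 s i) ∨
    ∃ (s : ℤ) (a : Fin ℓ), s ≤ t ∧ f = M.obsL2 s a}).topologicalClosure

theorem stateL2_mem_hist {s t : ℤ} (h : s ≤ t) (i : Fin n) : M.stateL2 s i ∈ M.hist t :=
  Submodule.le_topologicalClosure _ (Submodule.subset_span (Or.inl ⟨s, i, h, rfl⟩))

theorem obsL2_mem_hist {s t : ℤ} (h : s ≤ t) (a : Fin ℓ) : M.obsL2 s a ∈ M.hist t :=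
  Submodule.le_topologicalClosure _ (Submodule.subset_span (Or.inr ⟨s, a, h, rfl⟩))

theorem obsL2_mem_past {s t : ℤ} (h : s ≤ t) (a : Fin ℓ) : M.obsL2 s a ∈ M.past t :=
  Submodule.le_topologicalClosure _ (Submodule.subset_span ⟨s, a, h, rfl⟩)

theorem past_le_hist (t : ℤ) : M.past t ≤ M.hist t :=
  Submodule.topologicalClosure_mono (Submodule.span_mono fun _ h => Or.inr h)

theorem hist_mono {s t : ℤ} (h : s ≤ t) : M.hist s ≤ M.hist t := by
  refine Submodule.topologicalClosure_mono (Submodule.span_mono ?_)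
  rintro _ (⟨r, i, hr, rfl⟩ | ⟨r, a, hr, rfl⟩)
  · exact Or.inl ⟨r, i, hr.trans h, rfl⟩
  · exact Or.inr ⟨r, a, hr.trans h, rfl⟩

theorem past_mono {s t : ℤ} (h : s ≤ t) : M.past s ≤ M.past t :=
  Submodule.topologicalClosure_mono
    (Submodule.span_mono fun _ ⟨r, a, hr, hf⟩ => ⟨r, a, hr.trans h, hf⟩)

/-- The noise `x_{t+1} - A x_t` of the state equation. -/
def stateNoiseL2 (t : ℤ) (i : Fin n) : Lp ℝ 2 μ :=
  M.stateL2 (t + 1) i - linComb (M.stateL2 t) (M.A i)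

/-- The noise `η_{t+1} = y_{t+1} - C x_t` of the observation equation. -/
def obsNoiseL2 (t : ℤ) (a : Fin ℓ) : Lp ℝ 2 μ :=
  M.obsL2 (t + 1) a - linComb (M.stateL2 t) (M.C a)

theorem inner_stateNoiseL2_of_mem_hist {t : ℤ} {f : Lp ℝ 2 μ} (hf : f ∈ M.hist t) (i : Fin n) :
    inner ℝ (M.stateNoiseL2 t i) f = 0 := by
  refine inner_eq_zero_of_mem_closure_span ?_ f hf
  rintro f (⟨s, j, hs, rfl⟩ | ⟨s, a, hs, rfl⟩)
  · rw [stateNoiseL2, inner_sub_left, inner_stateL2_succ_stateL2 _ hs, inner_linComb_left, sub_self]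
  · rw [stateNoiseL2, inner_sub_left, inner_stateL2_succ_obsL2 _ hs, inner_linComb_left, sub_self]

theorem inner_obsNoiseL2_of_mem_hist {t : ℤ} {f : Lp ℝ 2 μ} (hf : f ∈ M.hist t) (a : Fin ℓ) :
    inner ℝ (M.obsNoiseL2 t a) f = 0 := by
  refine inner_eq_zero_of_mem_closure_span ?_ f hf
  rintro f (⟨s, j, hs, rfl⟩ | ⟨s, b, hs, rfl⟩)
  · rw [obsNoiseL2, inner_sub_left, inner_obsL2_succ_stateL2 _ hs, inner_linComb_left, sub_self]
  · rw [obsNoiseL2, inner_sub_left, inner_obsL2_succ_obsL2 _ hs, inner_linComb_left, sub_self]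

/-- Conditional independence of `x_{t+1}` and `y_{t+1}` given `x_t`: both moments equal `∑ j, A i j
* C b j * π j`. -/
theorem inner_stateL2_succ_obsNoiseL2 (t : ℤ) (i : Fin n) (b : Fin ℓ) :
    inner ℝ (M.stateL2 (t + 1) i) (M.obsNoiseL2 t b) = 0 := by
  rw [obsNoiseL2, inner_sub_right, inner_stateL2_obsL2_self, inner_linComb_right]
  simp only [inner_stateL2_succ_stateL2 M le_rfl, inner_stateL2_stateL2_self]
  rw [sub_eq_zero]
  refine Finset.sum_congr rfl fun j _ => ?_
  simp
  ring

theorem inner_stateNoiseL2_obsNoiseL2 (t : ℤ) (i : Fin n) (b : Fin ℓ) :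
    inner ℝ (M.stateNoiseL2 t i) (M.obsNoiseL2 t b) = 0 := by
  rw [stateNoiseL2, inner_sub_left, inner_stateL2_succ_obsNoiseL2, real_inner_comm,
    M.inner_obsNoiseL2_of_mem_hist (linComb_mem (fun j => M.stateL2_mem_hist le_rfl j) _), sub_zero]

theorem obsNoiseL2_mem_hist {s t : ℤ} (h : s < t) (a : Fin ℓ) : M.obsNoiseL2 s a ∈ M.hist t :=
  Submodule.sub_mem _ (M.obsL2_mem_hist h a)
    (linComb_mem (fun j => M.stateL2_mem_hist h.le j) _)

/-- This holds at later times too, since observations do not feed back into the chain. It is what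
makes each noise vector uncorrelated with all observations but one, past and future. -/
theorem inner_stateL2_obsNoiseL2 (s t : ℤ) (i : Fin n) (b : Fin ℓ) :
    inner ℝ (M.stateL2 s i) (M.obsNoiseL2 t b) = 0 := by
  rcases le_or_gt s t with hs | hs
  · rw [real_inner_comm, M.inner_obsNoiseL2_of_mem_hist (M.stateL2_mem_hist hs i)]
  · revert i
    induction s, hs using Int.leInduction with
    | base => intro i; exact M.inner_stateL2_succ_obsNoiseL2 t i b
    | succ s hs ih =>
      intro i
      have h : M.stateL2 (s + 1) i = M.stateNoiseL2 s i + linComb (M.stateL2 s) (M.A i) := by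
        rw [stateNoiseL2, sub_add_cancel]
      rw [h, inner_add_left, M.inner_stateNoiseL2_of_mem_hist (M.obsNoiseL2_mem_hist hs b),
        inner_linComb_left]
      simp [ih]

theorem inner_obsL2_obsNoiseL2_of_ne {s t : ℤ} (h : s ≠ t + 1) (a b : Fin ℓ) :
    inner ℝ (M.obsL2 s a) (M.obsNoiseL2 t b) = 0 := by
  rcases lt_or_gt_of_ne h with h | h
  · rw [real_inner_comm, M.inner_obsNoiseL2_of_mem_hist (M.obsL2_mem_hist (by omega) a)]
  · obtain ⟨r, rfl⟩ : ∃ r, s = r + 1 := ⟨s - 1, by ring⟩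
    have h' : M.obsL2 (r + 1) a = M.obsNoiseL2 r a + linComb (M.stateL2 r) (M.C a) := by
      rw [obsNoiseL2, sub_add_cancel]
    rw [h', inner_add_left, M.inner_obsNoiseL2_of_mem_hist (M.obsNoiseL2_mem_hist (by omega) b),
      inner_linComb_left]
    simp [inner_stateL2_obsNoiseL2]

theorem inner_obsL2_succ_obsNoiseL2 (t : ℤ) (a b : Fin ℓ) :
    inner ℝ (M.obsL2 (t + 1) a) (M.obsNoiseL2 t b) =
      inner ℝ (M.obsNoiseL2 t a) (M.obsNoiseL2 t b) := by
  have h : M.obsL2 (t + 1) a = M.obsNoiseL2 t a + linComb (M.stateL2 t) (M.C a) := by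
    rw [obsNoiseL2, sub_add_cancel]
  rw [h, inner_add_left, inner_linComb_left]
  simp [inner_stateL2_obsNoiseL2]

theorem memLp_obsNoise (t : ℤ) (a : Fin ℓ) : MemLp (M.obsNoise t a) 2 μ :=
  (M.memLp_obsVec t a).sub
    (memLp_finsetSum Finset.univ fun i _ => (M.memLp_stateVec (t - 1) i).const_mul (M.C a i))

theorem toLp_obsNoise (t : ℤ) (a : Fin ℓ) :
    (M.memLp_obsNoise (t + 1) a).toLp (M.obsNoise (t + 1) a) = M.obsNoiseL2 t a := by
  have h : MemLp (fun ω => ∑ i, M.C a i * M.stateVec t i ω) 2 μ :=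
    memLp_finsetSum _ fun i _ => (M.memLp_stateVec t i).const_mul _
  have h1 := toLp_sum_mul (M.memLp_stateVec t) (M.C a) h
  rw [obsNoiseL2]
  have h2 : linComb (M.stateL2 t) (M.C a) = h.toLp _ := h1.symm
  rw [h2, obsL2, ← MemLp.toLp_sub]
  congr 1
  ext ω
  simp [obsNoise, Matrix.mulVec, dotProduct]

theorem crossGram_obsNoiseL2 (t : ℤ) : crossGram (M.obsNoiseL2 t) (M.obsNoiseL2 t) = M.R := by
  have h : ∀ a b, inner ℝ (M.obsNoiseL2 t a) (M.obsNoiseL2 t b) =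
      inner ℝ (M.obsNoiseL2 (-1) a) (M.obsNoiseL2 (-1) b) := by
    intro a b
    rw [← inner_obsL2_succ_obsNoiseL2, ← inner_obsL2_succ_obsNoiseL2, obsNoiseL2, obsNoiseL2,
      inner_sub_right, inner_sub_right, inner_linComb_right, inner_linComb_right]
    have h1 := M.inner_obsL2_obsL2_shift (t + 1) (-1 + 1) (-1 + 1) a b
    have h2 := fun i => M.inner_stateL2_obsL2_shift (t + 1) (-1) (-1 + 1) i a
    rw [show (-1 + 1 + (t + 1) : ℤ) = t + 1 by ring] at h1 h2
    rw [show (-1 + (t + 1) : ℤ) = t by ring] at h2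
    rw [h1]
    refine congrArg _ (Finset.sum_congr rfl fun i _ => ?_)
    rw [real_inner_comm, h2, real_inner_comm]
  ext a b
  simp only [crossGram, Matrix.of_apply, R]
  rw [h, ← toLp_obsNoise, ← toLp_obsNoise, inner_toLp]
  rfl

/-- The constant function one. -/
def oneL2 (μ : Measure Ω) [IsProbabilityMeasure μ] : Lp ℝ 2 μ := (memLp_const 1).toLp fun _ => 1

theorem norm_oneL2 : ‖oneL2 μ‖ = 1 := by
  have h := inner_toLp (μ := μ) (memLp_const (1 : ℝ)) (memLp_const (1 : ℝ))
  simp only [mul_one, integral_const, probReal_univ, smul_eq_mul] at h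
  rw [← oneL2, real_inner_self_eq_norm_sq] at h
  exact (pow_eq_one_iff_of_nonneg (norm_nonneg _) two_ne_zero).1 h

theorem sum_stateL2 (t : ℤ) : linComb (M.stateL2 t) 1 = oneL2 μ := by
  have h : MemLp (fun ω => ∑ i, (1 : Fin n → ℝ) i * M.stateVec t i ω) 2 μ :=
    memLp_finsetSum _ fun i _ => (M.memLp_stateVec t i).const_mul _
  refine (toLp_sum_mul (M.memLp_stateVec t) 1 h).symm.trans ?_
  simp [sum_stateVec, oneL2]

theorem sum_obsL2 (t : ℤ) : linComb (M.obsL2 t) 1 = oneL2 μ := by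
  have h : MemLp (fun ω => ∑ i, (1 : Fin ℓ → ℝ) i * M.obsVec t i ω) 2 μ :=
    memLp_finsetSum _ fun i _ => (M.memLp_obsVec t i).const_mul _
  refine (toLp_sum_mul (M.memLp_obsVec t) 1 h).symm.trans ?_
  simp [sum_obsVec, oneL2]

theorem one_mem_past (t : ℤ) : oneL2 μ ∈ M.past t := by
  rw [← M.sum_obsL2 t]
  exact linComb_mem (fun a => M.obsL2_mem_past le_rfl a) _

theorem inner_stateL2_one (t : ℤ) (i : Fin n) : inner ℝ (M.stateL2 t i) (oneL2 μ) = M.statDist i := by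
  rw [stateL2, oneL2, inner_toLp]
  simp [integral_stateVec]

theorem inner_obsL2_one (t : ℤ) (a : Fin ℓ) :
    inner ℝ (M.obsL2 t a) (oneL2 μ) = (M.C *ᵥ M.statDist) a := by
  rw [obsL2, oneL2, inner_toLp]
  simp [integral_obsVec]

/-! ### The prediction error -/

/-- The error of the optimal linear predictor of the hidden state. -/
def predErr (t : ℤ) (i : Fin n) : Lp ℝ 2 μ := M.stateL2 t i - M.statePred t i

theorem statePred_mem_past (t : ℤ) (i : Fin n) : M.statePred t i ∈ M.past t :=
  Submodule.starProjection_apply_mem _ _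

theorem inner_predErr_of_mem_past {t : ℤ} {f : Lp ℝ 2 μ} (hf : f ∈ M.past t) (i : Fin n) :
    inner ℝ (M.predErr t i) f = 0 :=
  Submodule.starProjection_inner_eq_zero _ _ hf

theorem predErr_mem_hist (t : ℤ) (i : Fin n) : M.predErr t i ∈ M.hist t :=
  Submodule.sub_mem _ (M.stateL2_mem_hist le_rfl i) (M.past_le_hist t (M.statePred_mem_past t i))

theorem linComb_statePred (t : ℤ) (w : Fin n → ℝ) :
    linComb (M.statePred t) w = (M.past t).starProjection (linComb (M.stateL2 t) w) := by
  simp [linComb, statePred]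

theorem linComb_predErr (t : ℤ) (w : Fin n → ℝ) : linComb (M.predErr t) w =
    linComb (M.stateL2 t) w - (M.past t).starProjection (linComb (M.stateL2 t) w) := by
  rw [← linComb_statePred, ← linComb_sub]
  rfl

theorem norm_linComb_predErr_le (t : ℤ) (w : Fin n → ℝ) {f : Lp ℝ 2 μ} (hf : f ∈ M.past t) :
    ‖linComb (M.predErr t) w‖ ≤ ‖linComb (M.stateL2 t) w - f‖ := by
  rw [linComb_predErr, Submodule.starProjection_minimal]
  exact ciInf_le ⟨0, by rintro _ ⟨x, rfl⟩; exact norm_nonneg _⟩ (⟨f, hf⟩ : M.past t)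

/-- Second moments are shift invariant, so any finite combination of the past at time `t` has a
shifted copy that approximates the shifted state equally well; closure then reaches the optimal
predictor. As `h` may be negative, this inequality already gives equality. -/
theorem norm_linComb_predErr_add_le (t h : ℤ) (w : Fin n → ℝ) :
    ‖linComb (M.predErr (t + h)) w‖ ≤ ‖linComb (M.predErr t) w‖ := by
  -- The probability space carries no shift map; pairing each generator with its translate replaces
  -- it.
  set T : Set (Lp ℝ 2 μ × Lp ℝ 2 μ) :=
    {p | (∃ s i, p = (M.stateL2 s i, M.stateL2 (s + h) i)) ∨
      ∃ s a, p = (M.obsL2 s a, M.obsL2 (s + h) a)} with hT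
  have hTi : ∀ p ∈ T, ∀ q ∈ T, inner ℝ p.1 q.1 = inner ℝ p.2 q.2 := by
    rintro _ (⟨s, i, rfl⟩ | ⟨s, i, rfl⟩) _ (⟨s', i', rfl⟩ | ⟨s', i', rfl⟩)
    · exact (M.inner_stateL2_stateL2_shift h s s' i i').symm
    · exact (M.inner_stateL2_obsL2_shift h s s' i i').symm
    · rw [real_inner_comm, real_inner_comm (M.stateL2 (s' + h) i')]
      exact (M.inner_stateL2_obsL2_shift h s' s i' i).symm
    · exact (M.inner_obsL2_obsL2_shift h s s' i i').symm
  have hw : (linComb (M.stateL2 t) w, linComb (M.stateL2 (t + h)) w) ∈ Submodule.span ℝ T := by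
    have : (linComb (M.stateL2 t) w, linComb (M.stateL2 (t + h)) w) =
        ∑ i, w i • (M.stateL2 t i, M.stateL2 (t + h) i) := by
      ext1 <;> simp [linComb, Prod.fst_sum, Prod.snd_sum]
    rw [this]
    exact Submodule.sum_mem _ fun i _ => Submodule.smul_mem _ _
      (Submodule.subset_span (Or.inl ⟨t, i, rfl⟩))
  have hspan : ∀ f ∈ Submodule.span ℝ {f | ∃ (s : ℤ) (a : Fin ℓ), s ≤ t ∧ f = M.obsL2 s a},
      ∃ f' ∈ M.past (t + h), (f, f') ∈ Submodule.span ℝ T := by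
    intro f hf
    induction hf using Submodule.span_induction with
    | mem f hf =>
      obtain ⟨s, a, hs, rfl⟩ := hf
      exact ⟨M.obsL2 (s + h) a, M.obsL2_mem_past (by omega) a,
        Submodule.subset_span (Or.inr ⟨s, a, rfl⟩)⟩
    | zero => exact ⟨0, Submodule.zero_mem _, Submodule.zero_mem _⟩
    | add f g _ _ h1 h2 =>
      obtain ⟨f', hf', hf⟩ := h1
      obtain ⟨g', hg', hg⟩ := h2
      exact ⟨f' + g', Submodule.add_mem _ hf' hg', Submodule.add_mem _ hf hg⟩
    | smul c f _ h1 =>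
      obtain ⟨f', hf', hf⟩ := h1
      exact ⟨c • f', Submodule.smul_mem _ _ hf', Submodule.smul_mem _ c hf⟩
  have hle : ∀ f ∈ M.past t,
      ‖linComb (M.predErr (t + h)) w‖ ≤ ‖linComb (M.stateL2 t) w - f‖ := by
    have hcl : IsClosed {f : Lp ℝ 2 μ |
        ‖linComb (M.predErr (t + h)) w‖ ≤ ‖linComb (M.stateL2 t) w - f‖} :=
      isClosed_le continuous_const (by fun_prop)
    refine fun f hf => closure_minimal ?_ hcl hf
    intro f hf
    obtain ⟨f', hf', hff⟩ := hspan f hf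
    have hd := Submodule.sub_mem _ hw hff
    have hn := inner_fst_eq_inner_snd_of_mem_span hTi hd hd
    simp only [real_inner_self_eq_norm_sq] at hn
    have hn' := (pow_left_inj₀ (norm_nonneg _) (norm_nonneg _) two_ne_zero).1 hn
    exact (M.norm_linComb_predErr_le _ w hf').trans hn'.ge
  rw [M.linComb_predErr t w]
  exact hle _ (Submodule.starProjection_apply_mem _ _)

theorem norm_linComb_predErr_eq (s t : ℤ) (w : Fin n → ℝ) :
    ‖linComb (M.predErr s) w‖ = ‖linComb (M.predErr t) w‖ := by
  refine le_antisymm ?_ ?_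
  · simpa using M.norm_linComb_predErr_add_le t (s - t) w
  · simpa using M.norm_linComb_predErr_add_le s (t - s) w

theorem crossGram_predErr (t : ℤ) : crossGram (M.predErr t) (M.predErr t) = M.V := by
  -- Polarization: time invariance is known for norms only.
  have h : ∀ t i j, inner ℝ (M.predErr t i) (M.predErr t j) =
      (‖linComb (M.predErr t) (Pi.single i 1 + Pi.single j 1)‖ *
        ‖linComb (M.predErr t) (Pi.single i 1 + Pi.single j 1)‖ -
        ‖linComb (M.predErr t) (Pi.single i 1)‖ * ‖linComb (M.predErr t) (Pi.single i 1)‖ -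
        ‖linComb (M.predErr t) (Pi.single j 1)‖ * ‖linComb (M.predErr t) (Pi.single j 1)‖) / 2 := by
    intro t i j
    rw [linComb_add_coeff, linComb_single, linComb_single]
    exact real_inner_eq_norm_add_mul_self_sub_norm_mul_self_sub_norm_mul_self_div_two _ _
  ext i j
  change inner ℝ (M.predErr t i) (M.predErr t j) = inner ℝ (M.predErr 0 i) (M.predErr 0 j)
  rw [h, h]
  simp only [M.norm_linComb_predErr_eq t 0]

end StationaryHMM

end

noncomputable section

namespace StationaryHMM

variable {n ℓ : ℕ} {Ω : Type*} [MeasurableSpace Ω] {μ : Measure Ω} [IsProbabilityMeasure μ]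
  (M : StationaryHMM n ℓ μ)

/-! ### The Kalman recursion -/

/-- The innovation `y_{t+1} - C x̂_t`. -/
def innov (t : ℤ) (a : Fin ℓ) : Lp ℝ 2 μ :=
  M.obsL2 (t + 1) a - linComb (M.statePred t) (M.C a)

theorem innov_eq (t : ℤ) (a : Fin ℓ) :
    M.innov t a = linComb (M.predErr t) (M.C a) + M.obsNoiseL2 t a := by
  rw [show M.predErr t = fun i => M.stateL2 t i - M.statePred t i from rfl, linComb_sub, innov,
    obsNoiseL2]
  abel

theorem linComb_innov (t : ℤ) (w : Fin ℓ → ℝ) :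
    linComb (M.innov t) w = linComb (M.predErr t) (w ᵥ* M.C) + linComb (M.obsNoiseL2 t) w := by
  rw [show M.innov t = fun a => linComb (M.predErr t) (M.C a) + M.obsNoiseL2 t a from
    funext (M.innov_eq t), linComb_add, linComb_linComb]

theorem innov_mem_past (t : ℤ) (a : Fin ℓ) : M.innov t a ∈ M.past (t + 1) :=
  Submodule.sub_mem _ (M.obsL2_mem_past le_rfl a)
    (linComb_mem (fun i => M.past_mono (by omega) (M.statePred_mem_past t i)) _)

theorem inner_innov_of_mem_past {t : ℤ} {f : Lp ℝ 2 μ} (hf : f ∈ M.past t) (a : Fin ℓ) :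
    inner ℝ (M.innov t a) f = 0 := by
  rw [innov_eq, inner_add_left, inner_linComb_left,
    M.inner_obsNoiseL2_of_mem_hist (M.past_le_hist t hf)]
  simp [M.inner_predErr_of_mem_past hf]

theorem inner_obsNoiseL2_linComb_predErr (t : ℤ) (a : Fin ℓ) (w : Fin n → ℝ) :
    inner ℝ (M.obsNoiseL2 t a) (linComb (M.predErr t) w) = 0 :=
  M.inner_obsNoiseL2_of_mem_hist (linComb_mem (M.predErr_mem_hist t) w) a

theorem inner_stateNoiseL2_linComb_predErr (t : ℤ) (i : Fin n) (w : Fin n → ℝ) :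
    inner ℝ (M.stateNoiseL2 t i) (linComb (M.predErr t) w) = 0 :=
  M.inner_stateNoiseL2_of_mem_hist (linComb_mem (M.predErr_mem_hist t) w) i

theorem inner_linComb_predErr (t : ℤ) (w w' : Fin n → ℝ) :
    inner ℝ (linComb (M.predErr t) w) (linComb (M.predErr t) w') = w ⬝ᵥ (M.V *ᵥ w') := by
  rw [← dotProduct_crossGram_mulVec, crossGram_predErr]

theorem crossGram_innov (t : ℤ) :
    crossGram (M.innov t) (M.innov t) = M.R + M.C * M.V * M.Cᵀ := by
  ext a b
  rw [Matrix.add_apply, ← M.crossGram_obsNoiseL2 t]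
  simp only [crossGram, Matrix.of_apply]
  rw [innov_eq, innov_eq, inner_add_left, inner_add_right, inner_add_right,
    inner_obsNoiseL2_linComb_predErr,
    real_inner_comm (M.obsNoiseL2 t b), inner_obsNoiseL2_linComb_predErr, inner_linComb_predErr,
    Matrix.mul_assoc]
  simp [Matrix.mul_apply, dotProduct, Matrix.mulVec, add_comm]

/-- The one-step prediction error `x_{t+1} - A x̂_t`. -/
theorem stateL2_succ_sub (t : ℤ) (i : Fin n) :
    M.stateL2 (t + 1) i - linComb (M.statePred t) (M.A i) =
      linComb (M.predErr t) (M.A i) + M.stateNoiseL2 t i := by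
  rw [show M.predErr t = fun i => M.stateL2 t i - M.statePred t i from rfl, linComb_sub,
    stateNoiseL2]
  abel

theorem crossGram_innov_right (t : ℤ) :
    crossGram (fun i => M.stateL2 (t + 1) i - linComb (M.statePred t) (M.A i)) (M.innov t) =
      M.A * M.V * M.Cᵀ := by
  ext i b
  simp only [crossGram, Matrix.of_apply]
  rw [stateL2_succ_sub, innov_eq, inner_add_left, inner_add_right, inner_add_right,
    inner_stateNoiseL2_linComb_predErr, inner_stateNoiseL2_obsNoiseL2,
    real_inner_comm (M.obsNoiseL2 t b), inner_obsNoiseL2_linComb_predErr, inner_linComb_predErr,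
    Matrix.mul_assoc]
  simp [Matrix.mul_apply, dotProduct, Matrix.mulVec]

/-- The past at `t + 1` arises from the past at `t` by adjoining the innovation, which is orthogonal
to the latter. So the update is the regression of `x_{t+1} - A x̂_t` on the innovation, whose
coefficients `A V Cᵀ (R + C V Cᵀ)†` are the gain. -/
theorem statePred_succ (t : ℤ) (i : Fin n) :
    M.statePred (t + 1) i = linComb (M.statePred t) (M.A i) + linComb (M.innov t) (M.K i) := by
  have horth : ∀ b, inner ℝ (M.stateL2 (t + 1) i -
      (linComb (M.statePred t) (M.A i) + linComb (M.innov t) (M.K i))) (M.innov t b) = 0 := by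
    intro b
    have h := crossGram_mul_pinv_mul
      (fun i => M.stateL2 (t + 1) i - linComb (M.statePred t) (M.A i)) (M.innov t)
    rw [crossGram_innov_right, crossGram_innov, ← K, ← M.crossGram_innov t,
      ← M.crossGram_innov_right t] at h
    have h' := congrFun (congrFun h i) b
    rw [Matrix.mul_apply] at h'
    rw [← sub_sub, inner_sub_left, inner_linComb_left, sub_eq_zero]
    exact h'.symm
  have hpast : ∀ f ∈ M.past t, inner ℝ (M.stateL2 (t + 1) i -
      (linComb (M.statePred t) (M.A i) + linComb (M.innov t) (M.K i))) f = 0 := by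
    intro f hf
    rw [← sub_sub, inner_sub_left, stateL2_succ_sub, inner_add_left, inner_linComb_left,
      M.inner_stateNoiseL2_of_mem_hist (M.past_le_hist t hf), inner_linComb_left]
    simp [M.inner_predErr_of_mem_past hf, M.inner_innov_of_mem_past hf]
  refine Submodule.eq_starProjection_of_mem_of_inner_eq_zero ?_ ?_
  · refine Submodule.add_mem _ (linComb_mem (fun j => M.past_mono (by omega)
      (M.statePred_mem_past t j)) _) (linComb_mem (M.innov_mem_past t) _)
  · refine inner_eq_zero_of_mem_closure_span ?_
    rintro f ⟨s, a, hs, rfl⟩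
    rcases hs.lt_or_eq with hs | rfl
    · exact hpast _ (M.obsL2_mem_past (by omega) a)
    · have : M.obsL2 (t + 1) a = M.innov t a + linComb (M.statePred t) (M.C a) := by
        rw [innov, sub_add_cancel]
      rw [this, inner_add_right, horth, hpast _ (linComb_mem (M.statePred_mem_past t) _), add_zero]

theorem predErr_succ (t : ℤ) (i : Fin n) : M.predErr (t + 1) i =
    linComb (M.predErr t) ((M.A - M.K * M.C) i) + (M.stateNoiseL2 t i -
      linComb (M.obsNoiseL2 t) (M.K i)) := by
  have h1 : (M.A - M.K * M.C) i = M.A i + (-1 : ℝ) • (M.K i ᵥ* M.C) := by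
    ext j
    simp [Matrix.vecMul, Matrix.mul_apply, dotProduct, sub_eq_add_neg]
  rw [predErr, statePred_succ, ← sub_sub, stateL2_succ_sub, linComb_innov, h1, linComb_add_coeff,
    linComb_smul_coeff, neg_one_smul]
  abel

/-- The error at time one is a sum of three pairwise orthogonal parts and has the same norm as at
time zero. Discarding the state noise leaves the inequality. -/
theorem norm_linComb_predErr_sq_le (w : Fin n → ℝ) :
    ‖linComb (M.predErr 0) (w ᵥ* (M.A - M.K * M.C))‖ ^ 2 +
      ‖linComb (M.obsNoiseL2 0) (w ᵥ* M.K)‖ ^ 2 ≤ ‖linComb (M.predErr 0) w‖ ^ 2 := by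
  rw [M.norm_linComb_predErr_eq 0 (0 + 1) w, show M.predErr (0 + 1) = _ from
    funext (M.predErr_succ 0), linComb_add, linComb_sub, linComb_linComb, linComb_linComb]
  set u := linComb (M.predErr 0) (w ᵥ* (M.A - M.K * M.C)) with hu
  set v := linComb (M.stateNoiseL2 0) w with hv
  set z := linComb (M.obsNoiseL2 0) (w ᵥ* M.K) with hz
  have h1 : inner ℝ v u = 0 := by
    rw [hv, inner_linComb_left]; simp [u, inner_stateNoiseL2_linComb_predErr]
  have h2 : inner ℝ z u = 0 := by
    rw [hz, inner_linComb_left]; simp [u, inner_obsNoiseL2_linComb_predErr]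
  have h3 : inner ℝ v z = 0 := by
    rw [hv, hz, inner_linComb_left]
    simp [inner_linComb_right, inner_stateNoiseL2_obsNoiseL2]
  rw [norm_add_sq_real, norm_sub_sq_real, inner_sub_right, real_inner_comm v u,
    real_inner_comm z u, h3]
  rw [real_inner_comm] at h1 h2
  rw [real_inner_comm] at h1 h2
  rw [h1, h2]
  nlinarith [sq_nonneg ‖v‖]

theorem sum_statePred (t : ℤ) : linComb (M.statePred t) 1 = oneL2 μ := by
  rw [linComb_statePred, sum_stateL2]
  exact Submodule.starProjection_eq_self_iff.2 (M.one_mem_past t)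

theorem sum_predErr (t : ℤ) : linComb (M.predErr t) 1 = 0 := by
  rw [show M.predErr t = fun i => M.stateL2 t i - M.statePred t i from rfl, linComb_sub,
    sum_stateL2, sum_statePred, sub_self]

theorem sum_obsNoiseL2 (t : ℤ) : linComb (M.obsNoiseL2 t) 1 = 0 := by
  rw [show M.obsNoiseL2 t = fun a => M.obsL2 (t + 1) a - linComb (M.stateL2 t) (M.C a) from rfl,
    linComb_sub, linComb_linComb, one_vecMul_C, sum_stateL2, sum_obsL2, sub_self]

theorem sum_innov (t : ℤ) : linComb (M.innov t) 1 = 0 := by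
  rw [linComb_innov, one_vecMul_C, sum_predErr, sum_obsNoiseL2, add_zero]

/-- The coordinates of the innovation sum to zero, so the all-ones vector lies in the kernel of its
Gram matrix, and the pseudo-inverse kills that kernel. -/
theorem K_mulVec_one : M.K *ᵥ 1 = 0 := by
  rw [K, ← M.crossGram_innov 0, ← Matrix.mulVec_mulVec, pinv_mulVec_eq_zero, Matrix.mulVec_zero]
  · ext a b
    exact real_inner_comm (M.innov 0 a) (M.innov 0 b)
  · ext a
    rw [crossGram_mulVec, sum_innov, inner_zero_right]
    rfl

theorem one_vecMul_K : (1 : Fin n → ℝ) ᵥ* M.K = 0 := by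
  have h : (1 : Fin n → ℝ) ᵥ* M.V = 0 := by
    ext j
    have := M.inner_linComb_predErr 0 1 (Pi.single j 1)
    rw [sum_predErr, inner_zero_left] at this
    rw [Matrix.mulVec_single_one] at this
    exact this.symm
  rw [K, ← Matrix.vecMul_vecMul, ← Matrix.vecMul_vecMul, ← Matrix.vecMul_vecMul, one_vecMul_A, h,
    Matrix.zero_vecMul, Matrix.zero_vecMul]

theorem one_vecMul_A_sub : (1 : Fin n → ℝ) ᵥ* (M.A - M.K * M.C) = 1 := by
  rw [Matrix.vecMul_sub, one_vecMul_A, ← Matrix.vecMul_vecMul, one_vecMul_K, Matrix.zero_vecMul,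
    sub_zero]

theorem one_vecMul_A_sub_pow (j : ℕ) : (1 : Fin n → ℝ) ᵥ* (M.A - M.K * M.C) ^ j = 1 := by
  induction j with
  | zero => simp
  | succ j ih => rw [pow_succ, ← Matrix.vecMul_vecMul, ih, one_vecMul_A_sub]

/-! ### Centred variables -/

/-- The centred state `x_t - π`. -/
def stateC (t : ℤ) (i : Fin n) : Lp ℝ 2 μ := M.stateL2 t i - M.statDist i • oneL2 μ

/-- The centred observation `y_t - C π`. -/
def obsC (t : ℤ) (a : Fin ℓ) : Lp ℝ 2 μ := M.obsL2 t a - (M.C *ᵥ M.statDist) a • oneL2 μ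

/-- The centred prediction `x̂_t - π`. -/
def predC (t : ℤ) (i : Fin n) : Lp ℝ 2 μ := M.statePred t i - M.statDist i • oneL2 μ

theorem linComb_stateC (t : ℤ) (w : Fin n → ℝ) :
    linComb (M.stateC t) w = linComb (M.stateL2 t) w - (w ⬝ᵥ M.statDist) • oneL2 μ := by
  rw [← linComb_smul_vector, ← linComb_sub]; rfl

theorem linComb_predC (t : ℤ) (w : Fin n → ℝ) :
    linComb (M.predC t) w = linComb (M.statePred t) w - (w ⬝ᵥ M.statDist) • oneL2 μ := by
  rw [← linComb_smul_vector, ← linComb_sub]; rfl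

theorem linComb_obsC (t : ℤ) (w : Fin ℓ → ℝ) : linComb (M.obsC t) w =
    linComb (M.obsL2 t) w - (w ⬝ᵥ (M.C *ᵥ M.statDist)) • oneL2 μ := by
  rw [← linComb_smul_vector, ← linComb_sub]; rfl

theorem one_dotProduct_statDist : (1 : Fin n → ℝ) ⬝ᵥ M.statDist = 1 := by
  have h1 : inner ℝ (linComb (M.stateL2 0) 1) (oneL2 μ) = (1 : Fin n → ℝ) ⬝ᵥ M.statDist := by
    rw [inner_linComb_left]; simp only [inner_stateL2_one]; rfl
  rw [← h1, sum_stateL2, real_inner_self_eq_norm_sq, norm_oneL2, one_pow]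

theorem sum_stateC (t : ℤ) : linComb (M.stateC t) 1 = 0 := by
  rw [linComb_stateC, sum_stateL2, one_dotProduct_statDist, one_smul, sub_self]

theorem sum_predC (t : ℤ) : linComb (M.predC t) 1 = 0 := by
  rw [linComb_predC, sum_statePred, one_dotProduct_statDist, one_smul, sub_self]

theorem sum_obsC (t : ℤ) : linComb (M.obsC t) 1 = 0 := by
  rw [linComb_obsC, sum_obsL2, Matrix.dotProduct_mulVec, one_vecMul_C,
    one_dotProduct_statDist, one_smul, sub_self]

theorem predC_succ (t : ℤ) (i : Fin n) : M.predC (t + 1) i =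
    linComb (M.predC t) ((M.A - M.K * M.C) i) + linComb (M.obsC (t + 1)) (M.K i) := by
  have h1 : (M.A - M.K * M.C) i = M.A i + (-1 : ℝ) • (M.K i ᵥ* M.C) := by
    ext j
    simp [Matrix.vecMul, Matrix.mul_apply, dotProduct, sub_eq_add_neg]
  have h2 : M.A i ⬝ᵥ M.statDist = M.statDist i := congrFun M.mulVec_statDist i
  have h3 : linComb (M.innov t) (M.K i) = linComb (M.obsL2 (t + 1)) (M.K i) -
      linComb (M.statePred t) (M.K i ᵥ* M.C) := by
    rw [← linComb_linComb, ← linComb_sub]; rfl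
  rw [predC, statePred_succ, linComb_predC, linComb_obsC, h3, h1, linComb_add_coeff,
    linComb_smul_coeff, add_dotProduct, smul_dotProduct, h2, Matrix.dotProduct_mulVec, add_smul,
    neg_one_smul, smul_eq_mul, neg_one_mul, neg_smul]
  abel

theorem linComb_predC_succ (t : ℤ) (w : Fin n → ℝ) : linComb (M.predC (t + 1)) w =
    linComb (M.predC t) (w ᵥ* (M.A - M.K * M.C)) + linComb (M.obsC (t + 1)) (w ᵥ* M.K) := by
  rw [show M.predC (t + 1) = _ from funext (M.predC_succ t), linComb_add, linComb_linComb,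
    linComb_linComb]

/-- The filter run backwards for `k` steps. The sum carries the coefficients of `𝒦_k`, and the last
term is the whole truncation error. -/
theorem linComb_predC_eq_sum (k : ℕ) (w : Fin n → ℝ) : linComb (M.predC 0) w =
    ∑ j ∈ Finset.range k, linComb (M.obsC (-(j : ℕ))) (w ᵥ* ((M.A - M.K * M.C) ^ j * M.K)) +
      linComb (M.predC (-(k : ℕ))) (w ᵥ* (M.A - M.K * M.C) ^ k) := by
  induction k with
  | zero => simp
  | succ k ih =>
    rw [ih, Finset.sum_range_succ, add_assoc, pow_succ, ← Matrix.vecMul_vecMul,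
      ← Matrix.vecMul_vecMul]
    congr 1
    have h := M.linComb_predC_succ (-((k + 1 : ℕ) : ℤ)) (w ᵥ* (M.A - M.K * M.C) ^ k)
    rw [show (-((k + 1 : ℕ) : ℤ) + 1) = -(k : ℤ) by push_cast; ring] at h
    rw [h, add_comm]

/-- An indicator is its own square, so its squared norm is its inner product with the constant one;
Cauchy–Schwarz concludes. -/
theorem norm_stateL2_le (t : ℤ) (i : Fin n) : ‖M.stateL2 t i‖ ≤ 1 := by
  have h := M.inner_stateL2_one t i
  have h2 := M.inner_stateL2_stateL2_self t i i
  rw [if_pos rfl, real_inner_self_eq_norm_sq, ← h] at h2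
  have h3 := real_inner_le_norm (M.stateL2 t i) (oneL2 μ)
  rw [norm_oneL2, mul_one, ← h2] at h3
  by_contra! hc
  nlinarith

theorem norm_obsL2_le (t : ℤ) (a : Fin ℓ) : ‖M.obsL2 t a‖ ≤ 1 := by
  have h := M.inner_obsL2_one t a
  have h2 := M.inner_obsL2_obsL2_self t a a
  rw [if_pos rfl, real_inner_self_eq_norm_sq, ← h] at h2
  have h3 := real_inner_le_norm (M.obsL2 t a) (oneL2 μ)
  rw [norm_oneL2, mul_one, ← h2] at h3
  by_contra! hc
  nlinarith

end StationaryHMM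

end

noncomputable section

namespace StationaryHMM

variable {n ℓ : ℕ} {Ω : Type*} [MeasurableSpace Ω] {μ : Measure Ω} [IsProbabilityMeasure μ]
  (M : StationaryHMM n ℓ μ)

/-! ### Consequences of the noise condition and of the rank condition -/

variable {M} in
-- The noise coordinates sum to zero, so the one-dimensional kernel of `R` is spanned by the
-- all-ones vector and meets the sum-zero hyperplane trivially.
theorem NoiseCondition.eq_zero (hM : M.NoiseCondition) {u : Fin ℓ → ℝ} (hu : ∑ a, u a = 0)
    {t : ℤ} (h : linComb (M.obsNoiseL2 t) u = 0) : u = 0 := by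
  rcases Nat.eq_zero_or_pos ℓ with rfl | hℓ
  · exact Subsingleton.elim _ _
  have hmem : ∀ v : Fin ℓ → ℝ, linComb (M.obsNoiseL2 t) v = 0 →
      v ∈ Module.End.eigenspace (Matrix.toLin' M.R) 0 := by
    intro v hv
    rw [Module.End.mem_eigenspace_iff, zero_smul, Matrix.toLin'_apply, ← M.crossGram_obsNoiseL2 t]
    ext a
    rw [crossGram_mulVec, hv, inner_zero_right]
    rfl
  have hne : (⟨1, hmem 1 (M.sum_obsNoiseL2 t)⟩ :
      Module.End.eigenspace (Matrix.toLin' M.R) 0) ≠ 0 := by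
    intro h0
    have := congrFun (congrArg Subtype.val h0) ⟨0, hℓ⟩
    simp at this
  obtain ⟨c, hc⟩ := (finrank_eq_one_iff_of_nonzero' _ hne).1 hM ⟨u, hmem u h⟩
  have hc' : c • (1 : Fin ℓ → ℝ) = u := congrArg Subtype.val hc
  have hℓ' : (ℓ : ℝ) ≠ 0 := by exact_mod_cast hℓ.ne'
  rw [← hc'] at hu
  simp [hℓ'] at hu
  rw [← hc', hu, zero_smul]

theorem norm_linComb_obsNoiseL2_sq (t : ℤ) (u : Fin ℓ → ℝ) :
    ‖linComb (M.obsNoiseL2 t) u‖ ^ 2 = u ⬝ᵥ (M.R *ᵥ u) := by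
  rw [norm_linComb_sq, crossGram_obsNoiseL2]

variable {M} in
theorem NoiseCondition.exists_pos_le (hM : M.NoiseCondition) :
    ∃ c : ℝ, 0 < c ∧ ∀ (t : ℤ) (u : Fin ℓ → ℝ), ∑ a, u a = 0 →
      c * ‖u‖ ^ 2 ≤ ‖linComb (M.obsNoiseL2 t) u‖ ^ 2 := by
  -- The family is constant in its index, so the horizon returned is irrelevant.
  obtain ⟨-, c, hc, h⟩ := exists_pos_mul_sq_norm_le
    (fun _ u => ‖linComb (M.obsNoiseL2 0) u‖ ^ 2)
    (fun _ => (continuous_linComb _).norm.pow 2) (fun _ _ _ _ => le_rfl)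
    (fun _ c w => by simp only [linComb_smul_coeff, norm_smul, mul_pow, Real.norm_eq_abs, sq_abs])
    (fun u hu hu0 => ⟨0, by
      have : linComb (M.obsNoiseL2 0) u ≠ 0 := fun h => hu (hM.eq_zero hu0 h)
      positivity⟩)
  refine ⟨c, hc, fun t u hu => ?_⟩
  rw [norm_linComb_obsNoiseL2_sq, ← M.norm_linComb_obsNoiseL2_sq 0]
  exact h u hu

variable {M} in
theorem RankCondition.pos (hM : M.RankCondition) : 0 < n := by
  rcases Nat.eq_zero_or_pos n with rfl | h
  · simpa using hM.2
  · exact h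

variable {M} in
-- All columns of `𝒦` have sum zero, and rank `n - 1` forces them to span that hyperplane. So `w`
-- lies in their span while being orthogonal to it.
theorem RankCondition.eq_zero (hM : M.RankCondition) {w : Fin n → ℝ} (hw : ∑ i, w i = 0)
    (h : ∀ j : ℕ, w ᵥ* ((M.A - M.K * M.C) ^ j * M.K) = 0) : w = 0 := by
  have hn := hM.pos
  set S := Submodule.span ℝ (Set.range M.ctrlMat.col) with hS
  have hfin : Module.finrank ℝ S + 1 = n := by
    rw [hS, ← Matrix.eRank_toNat_eq_finrank]
    have h2 := hM.2
    have hne : M.ctrlMat.eRank ≠ ⊤ := by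
      intro h; rw [h] at h2; simp at h2
    obtain ⟨r, hr⟩ := ENat.ne_top_iff_exists.1 hne
    rw [← hr] at h2 ⊢
    exact_mod_cast h2
  let φ : Module.Dual ℝ (Fin n → ℝ) := Fintype.linearCombination ℝ (fun _ : Fin n => (1 : ℝ))
  have hφ : ∀ v, φ v = ∑ i, v i := fun v => by simp [φ, Fintype.linearCombination_apply]
  have hφ0 : φ ≠ 0 := by
    intro h0
    have := hφ (Pi.single ⟨0, hn⟩ 1)
    simp [h0] at this
  have hle : S ≤ LinearMap.ker φ := by
    refine Submodule.span_le.2 ?_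
    rintro _ ⟨⟨j, b⟩, rfl⟩
    have h1 : (1 : Fin n → ℝ) ᵥ* ((M.A - M.K * M.C) ^ j * M.K) = 0 := by
      rw [← Matrix.vecMul_vecMul, one_vecMul_A_sub_pow, one_vecMul_K]
    have h2 := congrFun h1 b
    simp only [SetLike.mem_coe, LinearMap.mem_ker, hφ]
    simpa [Matrix.vecMul, dotProduct, ctrlMat] using h2
  have hSeq : S = LinearMap.ker φ := by
    refine Submodule.eq_of_le_of_finrank_eq hle ?_
    have := Module.Dual.finrank_ker_add_one_of_ne_zero hφ0
    rw [Module.finrank_fin_fun] at this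
    omega
  have hwS : w ∈ S := by rw [hSeq, LinearMap.mem_ker, hφ, hw]
  have hdot : ∀ v ∈ S, w ⬝ᵥ v = 0 := by
    intro v hv
    induction hv using Submodule.span_induction with
    | mem v hv =>
      obtain ⟨⟨j, b⟩, rfl⟩ := hv
      exact congrFun (h j) b
    | zero => simp
    | add u v _ _ h1 h2 => rw [dotProduct_add, h1, h2, add_zero]
    | smul c v _ h1 => rw [dotProduct_smul, h1, smul_zero]
  exact dotProduct_self_eq_zero.1 (hdot w hwS)

/-! ### Exponential stability of the predictor -/

/-- The energy dissipated by the prediction error in `m` steps through the observation noise. -/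
def dissip (m : ℕ) (w : Fin n → ℝ) : ℝ :=
  ∑ j ∈ Finset.range m, ‖linComb (M.obsNoiseL2 0) (w ᵥ* ((M.A - M.K * M.C) ^ j * M.K))‖ ^ 2

theorem dissip_mono (w : Fin n → ℝ) : Monotone fun m => M.dissip m w := by
  refine monotone_nat_of_le_succ fun m => ?_
  simp only [dissip, Finset.sum_range_succ]
  exact le_add_of_nonneg_right (sq_nonneg _)

theorem norm_linComb_predErr_pow_sq_add_dissip_le (m : ℕ) (w : Fin n → ℝ) :
    ‖linComb (M.predErr 0) (w ᵥ* (M.A - M.K * M.C) ^ m)‖ ^ 2 + M.dissip m w ≤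
      ‖linComb (M.predErr 0) w‖ ^ 2 := by
  induction m with
  | zero => simp [dissip]
  | succ m ih =>
    have h := M.norm_linComb_predErr_sq_le (w ᵥ* (M.A - M.K * M.C) ^ m)
    rw [dissip, Finset.sum_range_succ, ← dissip, pow_succ (M.A - M.K * M.C),
      ← Matrix.vecMul_vecMul, ← Matrix.vecMul_vecMul]
    linarith

variable {M} in
theorem exists_dissip_ge (hR : M.RankCondition) (hN : M.NoiseCondition) :
    ∃ m : ℕ, 0 < m ∧ ∃ δ : ℝ, 0 < δ ∧ ∀ w, ∑ i, w i = 0 → δ * ‖w‖ ^ 2 ≤ M.dissip m w := by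
  obtain ⟨m, δ, hδ, h⟩ := exists_pos_mul_sq_norm_le M.dissip
    (fun m => continuous_finsetSum _ fun j _ => (((continuous_linComb _).comp
      (Continuous.matrix_vecMul continuous_id continuous_const)).norm.pow 2))
    M.dissip_mono
    (fun m c w => by
      simp only [dissip, Matrix.smul_vecMul, linComb_smul_coeff, norm_smul, mul_pow,
        Real.norm_eq_abs, sq_abs, Finset.mul_sum])
    (by
      intro w hw hw0
      by_contra! hle
      refine hw (hR.eq_zero hw0 fun j => hN.eq_zero (t := 0) ?_ ?_)
      · have : (w ᵥ* ((M.A - M.K * M.C) ^ j * M.K)) ⬝ᵥ 1 = 0 := by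
          rw [← Matrix.dotProduct_mulVec, ← Matrix.mulVec_mulVec, K_mulVec_one, Matrix.mulVec_zero,
            dotProduct_zero]
        simpa [dotProduct] using this
      · have h1 := hle (j + 1)
        have h2 : 0 ≤ M.dissip j w := Finset.sum_nonneg fun _ _ => sq_nonneg _
        rw [dissip, Finset.sum_range_succ, ← dissip] at h1
        have h3 := sq_nonneg ‖linComb (M.obsNoiseL2 0) (w ᵥ* ((M.A - M.K * M.C) ^ j * M.K))‖
        have h4 : ‖linComb (M.obsNoiseL2 0) (w ᵥ* ((M.A - M.K * M.C) ^ j * M.K))‖ ^ 2 = 0 := by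
          linarith
        exact norm_eq_zero.1 (pow_eq_zero_iff two_ne_zero |>.1 h4))
  exact ⟨m + 1, m.succ_pos, δ, hδ, fun w hw => (h w hw).trans (M.dissip_mono w m.le_succ)⟩

theorem exists_sub_smul_one_sum_eq_zero {m : ℕ} (hm : 0 < m) (w : Fin m → ℝ) :
    ∃ c : ℝ, ∑ i, (w - c • (1 : Fin m → ℝ)) i = 0 := by
  have hm' : (m : ℝ) ≠ 0 := by exact_mod_cast hm.ne'
  refine ⟨(∑ i, w i) / m, ?_⟩
  simp only [Pi.sub_apply, Pi.smul_apply, Pi.one_apply, smul_eq_mul, mul_one,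
    Finset.sum_sub_distrib, Finset.sum_const, Finset.card_univ, Fintype.card_fin, nsmul_eq_mul]
  field_simp
  ring

theorem norm_statDist_smul_le (i : Fin n) : ‖M.statDist i • oneL2 μ‖ ≤ 1 := by
  rw [norm_smul, norm_oneL2, mul_one, ← M.inner_stateL2_one 0 i]
  refine (norm_inner_le_norm _ _).trans ?_
  rw [norm_oneL2, mul_one]
  exact M.norm_stateL2_le 0 i

theorem norm_predC_le (t : ℤ) (i : Fin n) : ‖M.predC t i‖ ≤ 2 := by
  have h1 : ‖M.statePred t i‖ ≤ 1 :=
    (Submodule.norm_starProjection_apply_le _ _).trans (M.norm_stateL2_le t i)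
  have h2 := M.norm_statDist_smul_le i
  exact (norm_sub_le _ _).trans (by linarith)

theorem norm_obsC_le (t : ℤ) (a : Fin ℓ) : ‖M.obsC t a‖ ≤ 2 := by
  have h1 := M.norm_obsL2_le t a
  have h2 : ‖(M.C *ᵥ M.statDist) a • oneL2 μ‖ ≤ 1 := by
    rw [norm_smul, norm_oneL2, mul_one, ← M.inner_obsL2_one 0 a]
    refine (norm_inner_le_norm _ _).trans ?_
    rw [norm_oneL2, mul_one]
    exact M.norm_obsL2_le 0 a
  exact (norm_sub_le _ _).trans (by linarith)

variable {M} in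
-- The error norm dominates the dissipated energy, hence `‖w‖` on sum-zero vectors, and `‖w‖`
-- dominates the bounded predictor. This transfers decay from errors to predictors.
theorem exists_norm_predC_sq_le (hR : M.RankCondition) (hN : M.NoiseCondition) :
    ∃ c : ℝ, 0 ≤ c ∧ ∀ (t : ℤ) (w : Fin n → ℝ),
      ‖linComb (M.predC t) w‖ ^ 2 ≤ c * ‖linComb (M.predErr 0) w‖ ^ 2 := by
  obtain ⟨m, -, δ, hδ, h⟩ := exists_dissip_ge hR hN
  refine ⟨(n * 2) ^ 2 / δ, by positivity, fun t w => ?_⟩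
  obtain ⟨c, hc⟩ := exists_sub_smul_one_sum_eq_zero hR.pos w
  -- Both families vanish on the all-ones vector, so only the sum-zero part of `w` counts.
  obtain ⟨v, rfl⟩ : ∃ v, w = v + c • (1 : Fin n → ℝ) := ⟨w - c • 1, by abel⟩
  rw [add_sub_cancel_right] at hc
  rw [linComb_add_coeff, linComb_add_coeff, linComb_smul_coeff, linComb_smul_coeff, sum_predErr,
    sum_predC, smul_zero, add_zero, add_zero]
  have h1 := h v hc
  have h2 := M.norm_linComb_predErr_pow_sq_add_dissip_le m v
  have h3 := sq_nonneg ‖linComb (M.predErr 0) (v ᵥ* (M.A - M.K * M.C) ^ m)‖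
  have h4 : ‖linComb (M.predC t) v‖ ≤ ‖v‖ * (n * 2) := by
    refine (norm_linComb_le _ _).trans (mul_le_mul_of_nonneg_left ?_ (norm_nonneg _))
    refine (Finset.sum_le_sum fun i _ => M.norm_predC_le t i).trans ?_
    simp
  calc ‖linComb (M.predC t) v‖ ^ 2 ≤ (‖v‖ * (n * 2)) ^ 2 := by gcongr
    _ = (n * 2) ^ 2 / δ * (δ * ‖v‖ ^ 2) := by field_simp
    _ ≤ _ := by
      refine mul_le_mul_of_nonneg_left ?_ (by positivity)
      linarith

variable {M} in
theorem exists_contraction (hR : M.RankCondition) (hN : M.NoiseCondition) :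
    ∃ m : ℕ, 0 < m ∧ ∃ θ : ℝ, 0 < θ ∧ θ < 1 ∧ ∀ w,
      ‖linComb (M.predErr 0) (w ᵥ* (M.A - M.K * M.C) ^ m)‖ ^ 2 ≤
        θ * ‖linComb (M.predErr 0) w‖ ^ 2 := by
  obtain ⟨m, hm, δ, hδ, h⟩ := exists_dissip_ge hR hN
  -- The summand `1` keeps `B` positive; the maximum with `1 / 2` below keeps the contraction factor
  -- positive.
  set B : ℝ := ∑ i, ‖M.predErr 0 i‖ + 1 with hB
  have hB0 : 0 < B := by positivity
  refine ⟨m, hm, max (1 - δ / B ^ 2) (1 / 2), by positivity,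
    max_lt (by have : 0 < δ / B ^ 2 := by positivity
               linarith) (by norm_num), fun w => ?_⟩
  obtain ⟨c, hc⟩ := exists_sub_smul_one_sum_eq_zero hR.pos w
  obtain ⟨v, rfl⟩ : ∃ v, w = v + c • (1 : Fin n → ℝ) := ⟨w - c • 1, by abel⟩
  rw [add_sub_cancel_right] at hc
  rw [Matrix.add_vecMul, Matrix.smul_vecMul, one_vecMul_A_sub_pow, linComb_add_coeff,
    linComb_add_coeff, linComb_smul_coeff, sum_predErr, smul_zero, add_zero, add_zero]
  have h1 := h v hc
  have h2 := M.norm_linComb_predErr_pow_sq_add_dissip_le m v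
  have h3 : ‖linComb (M.predErr 0) v‖ ≤ ‖v‖ * B :=
    (norm_linComb_le _ _).trans (mul_le_mul_of_nonneg_left (by linarith) (norm_nonneg _))
  have h4 : δ / B ^ 2 * ‖linComb (M.predErr 0) v‖ ^ 2 ≤ δ * ‖v‖ ^ 2 := by
    calc _ ≤ δ / B ^ 2 * (‖v‖ * B) ^ 2 := by gcongr
      _ = _ := by field_simp
  calc _ ≤ (1 - δ / B ^ 2) * ‖linComb (M.predErr 0) v‖ ^ 2 := by linarith
    _ ≤ _ := mul_le_mul_of_nonneg_right (le_max_left _ _) (sq_nonneg _)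

variable {M} in
theorem exists_norm_predC_pow_le (hR : M.RankCondition) (hN : M.NoiseCondition) :
    ∃ ρ : ℝ, 0 < ρ ∧ ρ < 1 ∧ ∃ c : ℝ, 0 ≤ c ∧ ∀ (k : ℕ) (t : ℤ) (w : Fin n → ℝ),
      ‖linComb (M.predC t) (w ᵥ* (M.A - M.K * M.C) ^ k)‖ ≤
        c * ρ ^ k * ‖linComb (M.predErr 0) w‖ := by
  obtain ⟨c₁, hc₁, h₁⟩ := exists_norm_predC_sq_le hR hN
  obtain ⟨m, hm, θ, hθ0, hθ1, hθ⟩ := exists_contraction hR hN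
  obtain ⟨ρ, hρ0, hρ1, c₂, hc₂, h₂⟩ := exists_geometric_bound hθ0 hθ1 hm
  -- The rate `ρ` belongs to squared norms, hence the square roots.
  refine ⟨√ρ, Real.sqrt_pos.2 hρ0, by rw [Real.sqrt_lt' one_pos]; simpa using hρ1, √(c₁ * c₂),
    Real.sqrt_nonneg _, fun k t w => ?_⟩
  have h := h₂ (fun k => ‖linComb (M.predErr 0) (w ᵥ* (M.A - M.K * M.C) ^ k)‖ ^ 2) (sq_nonneg _)
    (antitone_nat_of_succ_le fun k => by
      have := M.norm_linComb_predErr_sq_le (w ᵥ* (M.A - M.K * M.C) ^ k)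
      rw [Matrix.vecMul_vecMul, ← pow_succ] at this
      exact le_trans (le_add_of_nonneg_right (sq_nonneg _)) this)
    (fun k => by
      have := hθ (w ᵥ* (M.A - M.K * M.C) ^ k)
      rwa [Matrix.vecMul_vecMul, ← pow_add] at this) k
  simp only [pow_zero, Matrix.vecMul_one] at h
  refine (pow_le_pow_iff_left₀ (norm_nonneg _) (by positivity) two_ne_zero).1 ?_
  calc _ ≤ _ := h₁ t _
    _ ≤ c₁ * (c₂ * ρ ^ k * ‖linComb (M.predErr 0) w‖ ^ 2) := mul_le_mul_of_nonneg_left h hc₁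
    _ = _ := by
      rw [mul_pow, mul_pow, Real.sq_sqrt (by positivity), ← pow_mul, mul_comm k 2, pow_mul,
        Real.sq_sqrt hρ0.le]
      ring

/-! ### Prediction of the future -/

/-- The centred state has coordinate sum zero, so `A` and `Ā` act on it alike. -/
theorem stateC_succ (t : ℤ) (i : Fin n) :
    M.stateC (t + 1) i = linComb (M.stateC t) (M.Abar i) + M.stateNoiseL2 t i := by
  have h : M.Abar i = M.A i + (-M.statDist i) • (1 : Fin n → ℝ) := by
    ext j; simp [Abar, Matrix.vecMulVec_apply, sub_eq_add_neg]
  have h2 : M.A i ⬝ᵥ M.statDist = M.statDist i := congrFun M.mulVec_statDist i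
  rw [h, linComb_add_coeff, linComb_smul_coeff, sum_stateC, smul_zero, add_zero, linComb_stateC, h2,
    stateNoiseL2, stateC]
  abel

theorem obsC_succ (t : ℤ) (a : Fin ℓ) :
    M.obsC (t + 1) a = linComb (M.stateC t) (M.C a) + M.obsNoiseL2 t a := by
  have h2 : M.C a ⬝ᵥ M.statDist = (M.C *ᵥ M.statDist) a := rfl
  rw [linComb_stateC, h2, obsNoiseL2, obsC]
  abel

theorem inner_linComb_stateC_of_mem_hist {f : Lp ℝ 2 μ} (hf : f ∈ M.hist 0)
    (j : ℕ) (w : Fin n → ℝ) : inner ℝ (linComb (M.stateC j) w) f =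
      inner ℝ (linComb (M.stateC 0) (w ᵥ* M.Abar ^ j)) f := by
  induction j generalizing w with
  | zero => simp
  | succ j ih =>
    rw [Nat.cast_succ, show M.stateC ((j : ℤ) + 1) = _ from funext (M.stateC_succ j), linComb_add,
      linComb_linComb, inner_add_left, ih, Matrix.vecMul_vecMul, ← pow_succ',
      inner_linComb_left (M.stateNoiseL2 j)]
    simp [M.inner_stateNoiseL2_of_mem_hist (M.hist_mono (Int.natCast_nonneg j) hf)]

theorem inner_obsC_future {f : Lp ℝ 2 μ} (hf : f ∈ M.hist 0) (j : ℕ)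
    (a : Fin ℓ) : inner ℝ (M.obsC (1 + j) a) f =
      inner ℝ (linComb (M.stateC 0) ((M.C * M.Abar ^ j) a)) f := by
  rw [add_comm, obsC_succ, inner_add_left, M.inner_obsNoiseL2_of_mem_hist (M.hist_mono (Int.natCast_nonneg j) hf),
    add_zero, M.inner_linComb_stateC_of_mem_hist hf]
  rfl

theorem linComb_stateC_mem_hist (t : ℤ) (w : Fin n → ℝ) :
    linComb (M.stateC t) w ∈ M.hist t :=
  linComb_mem (fun i => Submodule.sub_mem _ (M.stateL2_mem_hist le_rfl i)
    (Submodule.smul_mem _ _ (M.past_le_hist t (M.one_mem_past t)))) w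

/-- The row of `C Ā^j` applied to the centred state is what a future observation shows of the
present history, so Cauchy–Schwarz bounds it by the norm of that observation. The bound is uniform
in `j`, hence over all rows of `𝒪`. -/
theorem norm_linComb_predErr_obsMat_le (j : ℕ) (a : Fin ℓ) :
    ‖linComb (M.predErr 0) ((M.C * M.Abar ^ j) a)‖ ≤ 2 := by
  set o := (M.C * M.Abar ^ j) a with ho
  have h1 := M.norm_linComb_predErr_le 0 o
    (Submodule.smul_mem _ (o ⬝ᵥ M.statDist) (M.one_mem_past 0))
  rw [← linComb_stateC] at h1
  refine h1.trans ?_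
  have h2 := M.inner_obsC_future (M.linComb_stateC_mem_hist 0 o) j a
  rw [← ho, real_inner_self_eq_norm_sq] at h2
  have h3 := real_inner_le_norm (M.obsC (1 + j) a) (linComb (M.stateC 0) o)
  have h4 := M.norm_obsC_le (1 + j) a
  rw [h2] at h3
  by_contra! hc
  nlinarith

end StationaryHMM

end

noncomputable section

namespace StationaryHMM

variable {n ℓ : ℕ} {Ω : Type*} [MeasurableSpace Ω] {μ : Measure Ω} [IsProbabilityMeasure μ]
  (M : StationaryHMM n ℓ μ)

/-! ### The weight matrix of the finite-horizon predictor -/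

theorem memLp_obsCentred (t : ℤ) (a : Fin ℓ) : MemLp (M.obsCentred t a) 2 μ :=
  (M.memLp_obsVec t a).sub (memLp_const _)

theorem toLp_obsCentred (t : ℤ) (a : Fin ℓ) :
    (M.memLp_obsCentred t a).toLp (M.obsCentred t a) = M.obsC t a := by
  rw [obsC, oneL2, obsL2, ← MemLp.toLp_const_smul, ← MemLp.toLp_sub]
  congr 1
  ext ω
  simp [obsCentred]

/-- The stacked future as a family in `L²`. -/
def futureL2 (k : ℕ) (p : Fin k × Fin ℓ) : Lp ℝ 2 μ := M.obsC (1 + (p.1 : ℕ)) p.2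

/-- The stacked past as a family in `L²`. -/
def pastL2 (k : ℕ) (p : Fin k × Fin ℓ) : Lp ℝ 2 μ := M.obsC (-(p.1 : ℕ)) p.2

theorem crossCov_eq (k : ℕ) : M.crossCov k = crossGram (M.futureL2 k) (M.pastL2 k) := by
  ext p q
  simp only [crossCov, crossGram, Matrix.of_apply, futureL2, pastL2, ← toLp_obsCentred, inner_toLp]
  rfl

theorem pastCov_eq (k : ℕ) : M.pastCov k = crossGram (M.pastL2 k) (M.pastL2 k) := by
  ext p q
  simp only [pastCov, crossGram, Matrix.of_apply, pastL2, ← toLp_obsCentred, inner_toLp]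
  rfl

theorem predMat_mul_pastCov (k : ℕ) : M.predMat k * M.pastCov k = M.crossCov k := by
  rw [predMat, crossCov_eq, pastCov_eq, crossGram_mul_pinv_mul]

theorem linComb_pastL2 (k : ℕ) (v : Fin k × Fin ℓ → ℝ) :
    linComb (M.pastL2 k) v =
      ∑ r : Fin k, linComb (M.obsC (-(r : ℕ))) (fun b => v (r, b)) := by
  rw [linComb, Fintype.sum_prod_type]
  rfl

theorem pastL2_mem_past (k : ℕ) (q : Fin k × Fin ℓ) : M.pastL2 k q ∈ M.past 0 :=
  Submodule.sub_mem _ (M.obsL2_mem_past (by omega) _) (Submodule.smul_mem _ _ (M.one_mem_past 0))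

/-- The indicator of a block is in the kernel of `Γ_k`, since centred observations sum to zero, and
`Γ_k†` kills this kernel. Here the choice of the Moore–Penrose inverse matters: other solutions of
the normal equations need not have this property. -/
theorem sum_predMat_block (k : ℕ) (p : Fin k × Fin ℓ) (r : Fin k) :
    ∑ b, M.predMat k p (r, b) = 0 := by
  set v : Fin k × Fin ℓ → ℝ := fun q => if q.1 = r then 1 else 0 with hv
  have h0 : linComb (M.pastL2 k) v = 0 := by
    rw [linComb_pastL2, Finset.sum_eq_single r]
    · have : (fun b : Fin ℓ => v (r, b)) = 1 := by ext b; simp [hv]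
      rw [this, sum_obsC]
    · intro s _ hs
      simp [hv, hs, linComb]
    · simp
  have h1 : M.pastCov k *ᵥ v = 0 := by
    ext q
    rw [pastCov_eq, crossGram_mulVec, h0, inner_zero_right]
    rfl
  have hs : (M.pastCov k).IsSymm := by
    ext q q'
    rw [pastCov_eq]
    exact real_inner_comm (M.pastL2 k q) (M.pastL2 k q')
  have h2 : M.predMat k *ᵥ v = 0 := by
    rw [predMat, ← Matrix.mulVec_mulVec, pinv_mulVec_eq_zero hs h1, Matrix.mulVec_zero]
  have h3 := congrFun h2 p
  simp only [Matrix.mulVec, dotProduct, Fintype.sum_prod_type, hv, mul_ite, mul_one, mul_zero] at h3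
  rw [Finset.sum_eq_single r (fun s _ hs => by simp [hs]) (by simp)] at h3
  simpa using h3

theorem obsMatTrunc_mul_ctrlMatTrunc_apply (k : ℕ) (p q : Fin k × Fin ℓ) :
    (M.obsMatTrunc k * M.ctrlMatTrunc k) p q =
      ((M.C * M.Abar ^ (p.1 : ℕ)) p.2 ᵥ* ((M.A - M.K * M.C) ^ (q.1 : ℕ) * M.K)) q.2 := by
  simp [Matrix.mul_apply, obsMatTrunc, ctrlMatTrunc, obsMat, ctrlMat, Matrix.vecMul, dotProduct]

theorem inner_obsC_obsNoiseL2_of_ne {s t : ℤ} (h : s ≠ t + 1) (a b : Fin ℓ) :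
    inner ℝ (M.obsC s a) (M.obsNoiseL2 t b) = 0 := by
  rw [obsC, inner_sub_left, inner_obsL2_obsNoiseL2_of_ne _ h, real_inner_smul_left,
    ← M.sum_stateL2 t, inner_linComb_left]
  simp [inner_stateL2_obsNoiseL2]

theorem inner_obsC_succ_obsNoiseL2 (t : ℤ) (a b : Fin ℓ) :
    inner ℝ (M.obsC (t + 1) a) (M.obsNoiseL2 t b) =
      inner ℝ (M.obsNoiseL2 t a) (M.obsNoiseL2 t b) := by
  rw [obsC, inner_sub_left, inner_obsL2_succ_obsNoiseL2, real_inner_smul_left,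
    ← M.sum_stateL2 t, inner_linComb_left]
  simp [inner_stateL2_obsNoiseL2]

/-- Testing the combination against its own noise component `g` of block `r` removes all other
blocks and leaves `‖g‖²`; Cauchy–Schwarz concludes. -/
theorem norm_linComb_obsNoiseL2_le_norm_linComb_pastL2 (k : ℕ) (v : Fin k × Fin ℓ → ℝ)
    (r : Fin k) :
    ‖linComb (M.obsNoiseL2 (-(r : ℕ) - 1)) (fun b => v (r, b))‖ ≤ ‖linComb (M.pastL2 k) v‖ := by
  set u : Fin ℓ → ℝ := fun b => v (r, b) with hu
  set g := linComb (M.obsNoiseL2 (-(r : ℕ) - 1)) u with hg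
  have h : inner ℝ (linComb (M.pastL2 k) v) g = ‖g‖ ^ 2 := by
    rw [linComb_pastL2, sum_inner, Finset.sum_eq_single r]
    · have hr : (-((r : ℕ) : ℤ)) = -((r : ℕ) : ℤ) - 1 + 1 := by ring
      rw [← real_inner_self_eq_norm_sq, inner_linComb_left]
      conv_rhs => rw [hg, inner_linComb_left]
      refine Finset.sum_congr rfl fun a _ => ?_
      rw [inner_linComb_right, inner_linComb_right]
      have := fun b => M.inner_obsC_succ_obsNoiseL2 (-((r : ℕ) : ℤ) - 1) a b
      rw [← hr] at this
      simp only [this, hu]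
    · intro s _ hs
      have hne : (-((s : ℕ) : ℤ)) ≠ -((r : ℕ) : ℤ) - 1 + 1 := by
        intro he
        exact hs (Fin.ext (by omega))
      rw [inner_linComb_left]
      simp [hg, inner_linComb_right, M.inner_obsC_obsNoiseL2_of_ne hne]
    · simp
  have h2 := real_inner_le_norm (linComb (M.pastL2 k) v) g
  rw [h] at h2
  by_contra! hc
  have := (norm_nonneg (linComb (M.pastL2 k) v)).trans_lt hc
  nlinarith

/-- With `f` the left vector and `z` the remainder of the unrolled filter, `f - z` is the
finite-horizon prediction minus the infinite-horizon one. Both have the same inner products with the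
finite past, so `f` is the orthogonal projection of `z`. -/
theorem norm_linComb_pastL2_row_le (k : ℕ) (p : Fin k × Fin ℓ) :
    ‖linComb (M.pastL2 k) ((M.predMat k - M.obsMatTrunc k * M.ctrlMatTrunc k) p)‖ ≤
      ‖linComb (M.predC (-(k : ℕ)))
        ((M.C * M.Abar ^ (p.1 : ℕ)) p.2 ᵥ* (M.A - M.K * M.C) ^ k)‖ := by
  set o := (M.C * M.Abar ^ (p.1 : ℕ)) p.2 with ho
  set z := linComb (M.predC (-(k : ℕ))) (o ᵥ* (M.A - M.K * M.C) ^ k) with hz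
  set f := linComb (M.pastL2 k) ((M.predMat k - M.obsMatTrunc k * M.ctrlMatTrunc k) p) with hf
  have h1 : linComb (M.pastL2 k) ((M.obsMatTrunc k * M.ctrlMatTrunc k) p) =
      linComb (M.predC 0) o - z := by
    rw [M.linComb_predC_eq_sum k o, ← hz, add_sub_cancel_right, linComb_pastL2,
      ← Fin.sum_univ_eq_sum_range
        (fun j => linComb (M.obsC (-(j : ℕ))) (o ᵥ* ((M.A - M.K * M.C) ^ j * M.K))) k]
    refine Finset.sum_congr rfl fun r _ => congrArg _ (funext fun b => ?_)
    exact M.obsMatTrunc_mul_ctrlMatTrunc_apply k p (r, b)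
  have h2 : f = linComb (M.pastL2 k) (M.predMat k p) - (linComb (M.predC 0) o - z) := by
    rw [← h1, hf, eq_sub_iff_add_eq, ← linComb_add_coeff]
    congr 1
    ext q
    simp
  have horth : ∀ q, inner ℝ (f - z) (M.pastL2 k q) = 0 := by
    intro q
    have h3 : inner ℝ (linComb (M.pastL2 k) (M.predMat k p)) (M.pastL2 k q) =
        inner ℝ (M.futureL2 k p) (M.pastL2 k q) := by
      have := congrFun (congrFun (M.predMat_mul_pastCov k) p) q
      rw [crossCov_eq, pastCov_eq, Matrix.mul_apply] at this
      rw [inner_linComb_left]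
      exact this
    have h4 : inner ℝ (linComb (M.predC 0) o) (M.pastL2 k q) =
        inner ℝ (linComb (M.stateC 0) o) (M.pastL2 k q) := by
      have : linComb (M.stateC 0) o = linComb (M.predErr 0) o + linComb (M.predC 0) o := by
        rw [← linComb_add]
        congr 1
        ext1 i
        simp only [stateC, predErr, predC]
        abel
      rw [this, inner_add_left, inner_linComb_left (M.predErr 0)]
      simp [M.inner_predErr_of_mem_past (M.pastL2_mem_past k q)]
    have h5 := M.inner_obsC_future (M.past_le_hist 0 (M.pastL2_mem_past k q)) p.1 p.2
    rw [h2, sub_sub, sub_add_cancel, inner_sub_left, h3, h4, futureL2, h5, sub_self]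
  have h6 : inner ℝ (f - z) f = 0 := by
    rw [hf, inner_linComb_right, ← hf]
    simp [horth]
  rw [inner_sub_left, real_inner_self_eq_norm_sq, sub_eq_zero] at h6
  have h7 := real_inner_le_norm z f
  rw [← h6] at h7
  by_contra! hc
  have := (norm_nonneg z).trans_lt hc
  nlinarith

variable {M} in
theorem exists_abs_predMat_sub_le (hR : M.RankCondition) (hN : M.NoiseCondition) :
    ∃ ρ : ℝ, 0 < ρ ∧ ρ < 1 ∧ ∃ c : ℝ, 0 ≤ c ∧ ∀ (k : ℕ) (p q : Fin k × Fin ℓ),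
      |(M.predMat k - M.obsMatTrunc k * M.ctrlMatTrunc k) p q| ≤ c * ρ ^ k := by
  obtain ⟨ρ, hρ0, hρ1, c₁, hc₁, h₁⟩ := exists_norm_predC_pow_le hR hN
  obtain ⟨c₂, hc₂, h₂⟩ := hN.exists_pos_le
  refine ⟨ρ, hρ0, hρ1, (√c₂)⁻¹ * (c₁ * 2), by positivity, fun k p q => ?_⟩
  set D := (M.predMat k - M.obsMatTrunc k * M.ctrlMatTrunc k) p with hD
  have hsum : ∑ b, D (q.1, b) = 0 := by
    have h := congrArg (fun v => ((M.C * M.Abar ^ (p.1 : ℕ)) p.2 ᵥ* (M.A - M.K * M.C) ^ (q.1 : ℕ))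
      ⬝ᵥ v) M.K_mulVec_one
    simp only [dotProduct_zero] at h
    rw [Matrix.dotProduct_mulVec, Matrix.vecMul_vecMul] at h
    have h' : ∑ b, (M.obsMatTrunc k * M.ctrlMatTrunc k) p (q.1, b) = 0 := by
      simp only [obsMatTrunc_mul_ctrlMatTrunc_apply]
      simpa [dotProduct] using h
    simp only [hD, Matrix.sub_apply, Finset.sum_sub_distrib]
    rw [sum_predMat_block, h', sub_zero]
  have h3 := h₂ (-(q.1 : ℕ) - 1) (fun b => D (q.1, b)) hsum
  have h4 := M.norm_linComb_obsNoiseL2_le_norm_linComb_pastL2 k D q.1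
  have h5 := M.norm_linComb_pastL2_row_le k p
  have h6 := h₁ k (-(k : ℕ)) ((M.C * M.Abar ^ (p.1 : ℕ)) p.2)
  have h7 := M.norm_linComb_predErr_obsMat_le p.1 p.2
  have h8 : |D q| ≤ ‖fun b => D (q.1, b)‖ := norm_le_pi_norm (fun b => D (q.1, b)) q.2
  have h9 : √c₂ * ‖fun b => D (q.1, b)‖ ≤
      ‖linComb (M.obsNoiseL2 (-(q.1 : ℕ) - 1)) (fun b => D (q.1, b))‖ := by
    refine (pow_le_pow_iff_left₀ (by positivity) (norm_nonneg _) two_ne_zero).1 ?_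
    rwa [mul_pow, Real.sq_sqrt hc₂.le]
  have h10 : √c₂ * |D q| ≤ c₁ * ρ ^ k * 2 := by
    calc _ ≤ _ := mul_le_mul_of_nonneg_left h8 (Real.sqrt_nonneg _)
      _ ≤ _ := h9
      _ ≤ _ := h4
      _ ≤ _ := h5
      _ ≤ _ := h6
      _ ≤ _ := mul_le_mul_of_nonneg_left h7 (by positivity)
  have hs : 0 < √c₂ := Real.sqrt_pos.2 hc₂
  calc |D q| = (√c₂)⁻¹ * (√c₂ * |D q|) := by field_simp
    _ ≤ (√c₂)⁻¹ * (c₁ * ρ ^ k * 2) := mul_le_mul_of_nonneg_left h10 (by positivity)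
    _ = _ := by ring

end StationaryHMM

end

theorem proposition2 {n ℓ : ℕ} {Ω : Type*} [MeasurableSpace Ω] {μ : Measure Ω}
    [IsProbabilityMeasure μ] (M : StationaryHMM n ℓ μ)
    (hErgodic : M.Ergodic) (hRank : M.RankCondition) (hNoise : M.NoiseCondition) :
    ∃ ρ : ℝ, 0 < ρ ∧ ρ < 1 ∧
      (fun k : ℕ => ‖Matrix.toEuclideanCLM (𝕜 := ℝ)
          (M.predMat k - M.obsMatTrunc k * M.ctrlMatTrunc k)‖)
        =O[atTop] (fun k : ℕ => ρ ^ k) := by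
  obtain ⟨r, hr0, hr1, c, hc, h⟩ := StationaryHMM.exists_abs_predMat_sub_le hRank hNoise
  -- A rate strictly above `r` absorbs the factor `k²` from the `kℓ × kℓ` size of the matrices.
  obtain ⟨ρ, hrρ, hρ1⟩ := exists_between hr1
  refine ⟨ρ, hr0.trans hrρ, hρ1, ?_⟩
  have h1 : (fun k : ℕ => ‖Matrix.toEuclideanCLM (𝕜 := ℝ)
      (M.predMat k - M.obsMatTrunc k * M.ctrlMatTrunc k)‖)
      =O[atTop] (fun k : ℕ => (k : ℝ) ^ 2 * r ^ k) := by
    refine IsBigO.of_bound ((ℓ : ℝ) ^ 2 * c) (Eventually.of_forall fun k => ?_)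
    have h2 := norm_toEuclideanCLM_le (M.predMat k - M.obsMatTrunc k * M.ctrlMatTrunc k)
      (c := c * r ^ k) (by positivity) (h k)
    rw [norm_norm, Real.norm_of_nonneg (by positivity)]
    refine h2.trans (le_of_eq ?_)
    simp only [Fintype.card_prod, Fintype.card_fin, Nat.cast_mul]
    ring
  refine h1.trans (isLittleO_pow_const_mul_const_pow_const_pow_of_norm_lt 2 ?_).isBigO
  rwa [Real.norm_of_nonneg hr0.le]
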